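/- Let $\nu\ge 1$ be an integer and $j=2\nu+1$ (odd valence). Put $$\widehat{\mathcal F}_1(y)=\frac1{2\nu+1}\sum_{\mu=0}^{\nu}\frac{(2\nu+1)!}{(2\mu)!\,(\nu-\mu)!\,(\nu-\mu+1)!}\,y^\mu,\qquad \widehat B_{11}=2y^{1/2}\widehat{\mathcal F}_1'(y),\qquad \widehat B_{12}=(\nu+1)\widehat{\mathcal F}_1-y\,\widehat{\mathcal F}_1'(y),$$ so that $\widehat B_{12}$ and $\Lambda:=\widehat B_{12}-y^{1/2}\widehat B_{11}$ are real polynomials in $y$. Let $\mathcal C$ be the curve in the real $(\xi^2,y_0)$-plane that is the graph of $$\xi^2=\frac{y_0\,\Lambda(y_0)^{2\nu-1}}{(2\nu+1)^2\,\widehat B_{12}(y_0)^{2\nu+1}}\qquad(\widehat B_{12}(y_0)\ne0).$$ Put $z_0=\widehat B_{12}/\Lambda$ and, for $w>0$ and $y_0>0$, $f_0=wz_0$, $h_0=\sqrt{y_0}\sqrt{f_0}$ (with $\sqrt{y_0}>0$, and $\sqrt{f_0}$ imaginary where $z_0<0$), $r_\pm=h_0\pm2\sqrt{f_0}$, $d_\pm=(jw-(j-2)f_0)\pm(j-2)\sqrt{f_0}\,h_0$.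 A zero of $d_\mp/r_\pm$ is a value of $y_0$ at which $d_\mp/r_\pm$ has limit $0$ (so that a removable $0/0$ with non-zero limit is not a zero). Put $\widehat D=\widehat d_+\widehat d_-$ with $\widehat d_\pm=2-j\,y_0^{1/2}\widehat B_{11}/\widehat B_{12}\pm(j-2)y_0^{1/2}$. Then: (a) $\widehat B_{12}$ has exactly $\nu$ complex zeros $a_1<\dots<a_\nu$, all real and negative, and the horizontal asymptotes of $\mathcal C$ are exactly the lines $y_0=a_i$. At each $a_i$, $\xi^2$ tends to $+\infty$ as $y_0\uparrow a_i$ and to $-\infty$ as $y_0\downarrow a_i$, and has a pole of order $2\nu+1$ (the order of tangency to the asymptote). For consecutive asymptotes, the part of $\mathcal C$ with $a_i<y_0<a_{i+1}$ is a connected component of $\mathcal C$, on which $\xi^2$ is strictly increasing in $y_0$; it meets the $y_0$-axis in exactly one point, whose $y_0$-coordinate is the unique zero of $\Lambda$ in $(a_i,a_{i+1})$, and there $\xi^2$ has a zero of order $2\nu-1$ (vertical tangency). (b) The part of $\mathcal C$ with $y_0>a_\nu$ is a connected component. There are $0<y_R<y_0^*<4<y_L$ such that: $\xi^2$ is strictly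 increasing in $y_0$ on $(a_\nu,y_R]$ and vanishes at $y_0=0$; $\xi^2(y_R)>0$ and $y_R$ is a simple turning point ($d\xi^2/dy_0=0$, $d^2\xi^2/dy_0^2<0$) and a zero of $d_- /r_+$; $\xi^2$ is strictly decreasing on $[y_R,y_L]$; $y_0^*$ is the only positive zero of $\Lambda$ and the only $y_0>0$ at which $\mathcal C$ meets the $y_0$-axis, and $\xi^2$ has a zero of order $2\nu-1$ there; $\xi^2(y_L)<0$ and $y_L$ is a simple turning point ($d\xi^2/dy_0=0$, $d^2\xi^2/dy_0^2>0$), equal to the smallest positive zero of $d_+/r_-$; $\xi^2$ is strictly increasing on $[y_L,\infty)$ and tends to $0$ from below as $y_0\to+\infty$. The points $y_R,y_L$ are the only local extrema of $\xi^2$ on $\mathcal C$, i.e. the only real turning points. The part of $\mathcal C$ with $y_0<a_1$ is a connected component, on which $\xi^2$ is strictly increasing in $y_0$ and tends to $0$ from above as $y_0\to-\infty$. The order of vanishing of $\xi^2$ at $y_0=\pm\infty$, as a function of $1/y_0$, is $2\nu-1$ (the order of tangency to the $y_0$-axis). (c) $\widehat D$ is divisible by $y_0-4$: there is a real polynomial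 $N$ in $y_0$ of degree $2\nu$, coprime to $\widehat B_{12}$, with $$\frac{\widehat D}{y_0-4}=\frac{N(y_0)}{\widehat B_{12}(y_0)^2}.$$ -/

import Mathlib

open Polynomial Filter Topology Set

noncomputable section

namespace SpectralCurve

/-- The polynomial `F̂₁(y₀)`, with trinomial coefficients
`(2ν+1)! / ((2μ)! (ν-μ)! (ν-μ+1)!)`, in the variable `y₀`. -/
def F1 (ν : ℕ) : ℝ[X] :=
  C (1 / (2 * (ν : ℝ) + 1)) * ∑ μ ∈ Finset.range (ν + 1),
    C (((2 * ν + 1).factorial : ℝ) /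
      ((2 * μ).factorial * (ν - μ).factorial * (ν - μ + 1).factorial)) * X ^ μ

/-- `B̂₁₂ = (ν+1) F̂₁ - y₀ ∂F̂₁`, a polynomial in `y₀`. -/
def B12 (ν : ℕ) : ℝ[X] :=
  C ((ν : ℝ) + 1) * F1 ν - X * derivative (F1 ν)

/-- `B̂₁₁ = 2 y₀^{1/2} ∂F̂₁(y₀)`, a polynomial in the variable `ζ = y₀^{1/2}`. -/
def B11 (ν : ℕ) : ℝ[X] :=
  2 * X * (derivative (F1 ν)).comp (X ^ 2)

/-- `B̂₁₂ - y₀^{1/2} B̂₁₁`, which is a polynomial in `y₀`; see `lam_comp_sq`. -/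
def lam (ν : ℕ) : ℝ[X] :=
  B12 ν - 2 * X * derivative (F1 ν)

theorem lam_comp_sq (ν : ℕ) :
    (lam ν).comp (X ^ 2) = (B12 ν).comp (X ^ 2) - X * B11 ν := by
  simp only [lam, B11, sub_comp, mul_comp, X_comp, ofNat_comp]
  ring

/-- `ξ²` as a function of `y₀`. -/
def xiSq (ν : ℕ) (y : ℝ) : ℝ :=
  y * (lam ν).eval y ^ (2 * ν - 1) /
    ((2 * (ν : ℝ) + 1) ^ 2 * (B12 ν).eval y ^ (2 * ν + 1))

/-- The curve in the real `(ξ², y₀)`-plane. -/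
def curve (ν : ℕ) : Set (ℝ × ℝ) :=
  {p | (B12 ν).eval p.2 ≠ 0 ∧ p.1 = xiSq ν p.2}

/-- `S` is a connected component of the plane set `K`. -/
def IsComponent (K S : Set (ℝ × ℝ)) : Prop :=
  ∃ p ∈ K, connectedComponentIn K p = S

/-- The horizontal line at height `b` is an asymptote of the plane set `K`: there are points of `K`
with arbitrarily large `|ξ²|` and with `y₀` arbitrarily close to `b`. -/
def IsHorizontalAsymptote (K : Set (ℝ × ℝ)) (b : ℝ) : Prop :=
  ∀ M ε : ℝ, 0 < ε → ∃ p ∈ K, M < |p.1| ∧ |p.2 - b| < ε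

/-- `z₀ = B̂₁₂ / (B̂₁₂ - y₀^{1/2} B̂₁₁)`. -/
def z0 (ν : ℕ) (y : ℝ) : ℝ := (B12 ν).eval y / (lam ν).eval y

/-- `√f₀`, where `f₀ = w z₀`; it is imaginary where `z₀ < 0`. -/
def sqrtF0 (ν : ℕ) (w y : ℝ) : ℂ := ((w * z0 ν y : ℝ) : ℂ) ^ (1 / 2 : ℂ)

/-- `h₀ = √y₀ √f₀`, with the positive branch of `√y₀`, for `y₀ > 0`. -/
def h0 (ν : ℕ) (w y : ℝ) : ℂ := (Real.sqrt y : ℂ) * sqrtF0 ν w y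

/-- The Riemann invariants `r_± = h₀ ± 2 √f₀`; the sign is `σ = ±1`. -/
def r (σ : ℤ) (ν : ℕ) (w y : ℝ) : ℂ := h0 ν w y + σ * (2 * sqrtF0 ν w y)

/-- `d_± = (j w - (j-2) f₀) ± (j-2) √f₀ h₀` with `j = 2ν+1`; the sign is `σ = ±1`. -/
def d (σ : ℤ) (ν : ℕ) (w y : ℝ) : ℂ :=
  ((2 * (ν : ℂ) + 1) * w - (2 * (ν : ℂ) - 1) * ((w * z0 ν y : ℝ) : ℂ)) +
    σ * ((2 * (ν : ℂ) - 1) * sqrtF0 ν w y * h0 ν w y)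

/-- `y` is a zero of a function that is defined near `y` but possibly not at `y` (where
`d_∓ / r_±` may have the form `0 / 0`). -/
def IsZeroAt (g : ℝ → ℂ) (y : ℝ) : Prop := Tendsto g (𝓝[≠] y) (𝓝 0)

/-- `d̂_± = (2 - j (1 - 1/z₀)) ± (j-2) √y₀` with `1 - 1/z₀ = y₀^{1/2} B̂₁₁ / B̂₁₂` and `j = 2ν+1`,
as a function of `ζ = √y₀ ∈ ℂ`; the sign is `σ = ±1`. -/
def dHat (σ : ℤ) (ν : ℕ) (ζ : ℂ) : ℂ :=
  (2 - (2 * (ν : ℂ) + 1) * (ζ * aeval ζ (B11 ν) / aeval (ζ ^ 2) (B12 ν))) +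
    σ * ((2 * (ν : ℂ) - 1) * ζ)

/-- The scaled discriminant `D̂ = d̂_+ d̂_-`. -/
def DHat (ν : ℕ) (ζ : ℂ) : ℂ := dHat 1 ν ζ * dHat (-1) ν ζ

end SpectralCurve

end

noncomputable section

namespace SpectralCurve

/-! Write B = `B12`, Λ = `lam`, G = y₀^{1/2} B̂₁₁ and j = 2ν+1. The hypergeometric equation of `F1`
becomes a first-order linear system for (B, G), singular at 0 and 4. Eliminating derivatives through
it gives dξ²/dy₀ = W·T, where W = `weight` ≥ 0 contains only even powers and T = `turning` satisfies
(y₀-4)T = (j-2)² y₀ B² - (2B-jG)² = -B² D̂ (`turning_eq`). Monotonicity, turning points and part (c)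
thus all concern the one polynomial T, with N = -T.

For y₀ ≤ 0 both terms on the right are nonpositive, and they do not vanish together because B and G
have no common zero there; hence T > 0. For y₀ = ζ² > 0 the right side is -E(ζ)E(-ζ) with E = B d̂₊.
The polynomial `E` solves a scalar linear equation (`E_ode`) whose forcing has a known sign, since B
> 0 on [0,∞). Hence E has one zero -√y_R in (-2,2), a simple zero at 2, one zero √y_L in (2,∞), and
none on (-∞,-2]. The zero at 2 explains both the factor y₀-4 and the removable 0/0 of d₊/r₋, because
d_∓/r_± = √f₀ E(∓√y₀) / (B (√y₀ ± 2)).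

The zeros of B are real because B(-s²) is, up to sign, a member of an Appell sequence with
interlacing real zeros (`appell_two_mul`, `exists_strictMono_zeros_appell`). At a zero a of B the
system yields jΛ(a) = a(a-4)B'(a), which fixes the signs of ξ² on the two sides of the pole; the
behaviour at infinity follows from the leading coefficients 1 and 1-2ν of B and Λ. -/

/-! ### The hypergeometric equation of `F1`. -/

/-- Coefficients of `F1`. -/
theorem coeff_F1 (ν μ : ℕ) (h : μ ≤ ν) : (F1 ν).coeff μ =
    (1 / (2 * (ν : ℝ) + 1)) * (((2 * ν + 1).factorial : ℝ) /
      ((2 * μ).factorial * (ν - μ).factorial * (ν - μ + 1).factorial)) := by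
  simp only [F1, coeff_C_mul, finsetSum_coeff, coeff_X_pow]
  rw [Finset.sum_eq_single μ]
  · simp
  · intro b _ hb
    simp [Ne.symm hb]
  · intro hb
    simp at hb
    omega

theorem coeff_F1_of_lt (ν μ : ℕ) (h : ν < μ) : (F1 ν).coeff μ = 0 := by
  simp only [F1, coeff_C_mul, finsetSum_coeff, coeff_X_pow]
  rw [Finset.sum_eq_zero]
  · simp
  · intro b hb
    have : μ ≠ b := by
      simp at hb
      omega
    simp [this]

theorem coeff_F1_pos (ν μ : ℕ) (h : μ ≤ ν) : 0 < (F1 ν).coeff μ := by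
  rw [coeff_F1 ν μ h]
  positivity

/-- No bound on μ is needed: at μ = ν the factor ν-μ vanishes together with the next coefficient,
and beyond that both sides are 0. The differential equation can therefore be checked coefficient by
coefficient. -/
theorem coeff_F1_succ (ν μ : ℕ) :
    ((ν : ℝ) - μ) * (ν - μ + 1) * (F1 ν).coeff μ =
      (2 * μ + 2) * (2 * μ + 1) * (F1 ν).coeff (μ + 1) := by
  rcases lt_trichotomy μ ν with h | h | h
  · obtain ⟨k, rfl⟩ : ∃ k, ν = μ + 1 + k := ⟨ν - μ - 1, by omega⟩
    rw [coeff_F1 _ _ (by omega), coeff_F1 _ _ (by omega)]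
    have e1 : μ + 1 + k - μ = k + 1 := by omega
    have e2 : μ + 1 + k - (μ + 1) = k := by omega
    have e3 : 2 * (μ + 1) = 2 * μ + 1 + 1 := by ring
    rw [e1, e2, e3]
    simp only [Nat.factorial_succ (2 * μ), Nat.factorial_succ (2 * μ + 1), Nat.factorial_succ k,
      Nat.factorial_succ (k + 1)]
    have h1 : ((2 * μ).factorial : ℝ) ≠ 0 := by positivity
    have h2 : (k.factorial : ℝ) ≠ 0 := by positivity
    have h3 : (2 * ((μ : ℝ) + 1 + k) + 1) ≠ 0 := by positivity
    push_cast
    field_simp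
    ring
  · subst h
    rw [coeff_F1_of_lt μ (μ + 1) (by omega)]
    simp
  · rw [coeff_F1_of_lt ν μ h, coeff_F1_of_lt ν (μ + 1) (by omega)]
    simp

theorem coeff_X_mul_derivative' (p : ℝ[X]) (n : ℕ) :
    (X * derivative p).coeff n = n * p.coeff n := by
  cases n with
  | zero => simp
  | succ n => rw [coeff_X_mul, coeff_derivative]; push_cast; ring

/-- The hypergeometric equation of `F1`. -/
theorem F1_ode (ν : ℕ) :
    X * (X - 4) * derivative (derivative (F1 ν)) =
      (C (2 * (ν : ℝ)) * X + 2) * derivative (F1 ν) - C ((ν : ℝ) * (ν + 1)) * F1 ν := by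
  have key : X * derivative (X * derivative (F1 ν)) - X * derivative (F1 ν)
      - C 4 * (derivative (X * derivative (F1 ν)) - derivative (F1 ν)) =
      C (2 * (ν : ℝ)) * (X * derivative (F1 ν)) + C 2 * derivative (F1 ν)
        - C ((ν : ℝ) * (ν + 1)) * F1 ν := by
    ext n
    simp only [coeff_sub, coeff_add, coeff_C_mul, coeff_X_mul_derivative', coeff_derivative]
    push_cast
    linear_combination coeff_F1_succ ν n
  rw [derivative_mul, derivative_X] at key
  have h4 : (C 4 : ℝ[X]) = 4 := rfl
  have h2 : (C 2 : ℝ[X]) = 2 := rfl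
  rw [h4, h2] at key
  linear_combination key

/-! ### The linear system for `B12` and `G`. -/

/-- The polynomial `y₀^{1/2} B̂₁₁` in the variable `y₀`. -/
def G (ν : ℕ) : ℝ[X] := 2 * X * derivative (F1 ν)

theorem lam_eq (ν : ℕ) : lam ν = B12 ν - G ν := rfl

theorem coeff_B12 (ν μ : ℕ) : (B12 ν).coeff μ = ((ν : ℝ) + 1 - μ) * (F1 ν).coeff μ := by
  rw [B12, coeff_sub, coeff_C_mul, coeff_X_mul_derivative']
  ring

theorem coeff_G (ν μ : ℕ) : (G ν).coeff μ = 2 * μ * (F1 ν).coeff μ := by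
  have : G ν = C 2 * (X * derivative (F1 ν)) := by
    rw [G, show (C 2 : ℝ[X]) = 2 from rfl]; ring
  rw [this, coeff_C_mul, coeff_X_mul_derivative']
  ring

theorem coeff_F1_self (ν : ℕ) : (F1 ν).coeff ν = 1 := by
  rw [coeff_F1 ν ν le_rfl]
  simp only [Nat.sub_self, Nat.factorial_succ]
  have h1 : ((2 * ν).factorial : ℝ) ≠ 0 := by positivity
  have h3 : (2 * (ν : ℝ) + 1) ≠ 0 := by positivity
  push_cast
  field_simp
  simp

theorem coeff_B12_self (ν : ℕ) : (B12 ν).coeff ν = 1 := by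
  rw [coeff_B12, coeff_F1_self]; ring

theorem coeff_G_self (ν : ℕ) : (G ν).coeff ν = 2 * ν := by
  rw [coeff_G, coeff_F1_self]; ring

theorem coeff_lam_self (ν : ℕ) : (lam ν).coeff ν = 1 - 2 * ν := by
  rw [lam_eq, coeff_sub, coeff_B12_self, coeff_G_self]

theorem natDegree_B12_le (ν : ℕ) : (B12 ν).natDegree ≤ ν :=
  natDegree_le_iff_coeff_eq_zero.2 fun _ h => by rw [coeff_B12, coeff_F1_of_lt _ _ h, mul_zero]

theorem natDegree_G_le (ν : ℕ) : (G ν).natDegree ≤ ν :=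
  natDegree_le_iff_coeff_eq_zero.2 fun _ h => by rw [coeff_G, coeff_F1_of_lt _ _ h, mul_zero]

theorem natDegree_lam_le (ν : ℕ) : (lam ν).natDegree ≤ ν :=
  (natDegree_sub_le _ _).trans (max_le (natDegree_B12_le ν) (natDegree_G_le ν))

theorem natDegree_B12 (ν : ℕ) : (B12 ν).natDegree = ν :=
  natDegree_eq_of_le_of_coeff_ne_zero (natDegree_B12_le ν) (by simp [coeff_B12_self])

theorem B12_monic (ν : ℕ) : (B12 ν).Monic := by
  rw [Monic, leadingCoeff, natDegree_B12, coeff_B12_self]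

theorem lam_ne_zero (ν : ℕ) : lam ν ≠ 0 := by
  intro h
  have := coeff_lam_self ν
  rw [h, coeff_zero] at this
  have h2 : ((2 * ν : ℕ) : ℝ) = (1 : ℕ) := by push_cast; linarith
  have h3 := Nat.cast_injective h2
  omega

theorem eval_B12_pos (ν : ℕ) {y : ℝ} (hy : 0 ≤ y) : 0 < (B12 ν).eval y := by
  rw [eval_eq_sum_range, natDegree_B12]
  refine Finset.sum_pos' (fun i hi => ?_) ⟨0, by simp, ?_⟩
  · have hi' : i ≤ ν := by simpa [Nat.lt_succ_iff] using hi
    rw [coeff_B12]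
    have h1 := coeff_F1_pos ν i hi'
    have h2 : (i : ℝ) ≤ ν := by exact_mod_cast hi'
    have h3 : 0 ≤ (ν : ℝ) + 1 - i := by linarith
    positivity
  · rw [coeff_B12]
    have h1 := coeff_F1_pos ν 0 (Nat.zero_le _)
    simp
    positivity

/-- The first equation of the linear system satisfied by `B12` and `G`. -/
theorem B12_system (ν : ℕ) :
    X * (X - 4) * derivative (B12 ν) =
      C (ν : ℝ) * X * B12 ν - C (2 * (ν : ℝ) + 1) * G ν := by
  have h := F1_ode ν
  simp only [B12, G, derivative_sub, derivative_mul, derivative_add, derivative_one, derivative_C,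
    derivative_X, C_add, C_mul,
    C_1, show (C 2 : ℝ[X]) = 2 from rfl] at h ⊢
  linear_combination (-X) * h

/-- The second equation of the linear system satisfied by `B12` and `G`. -/
theorem G_system (ν : ℕ) :
    2 * X * (X - 4) * derivative (G ν) =
      (X - 4) * G ν + C (2 * (ν : ℝ) + 1) * X * G ν - C (4 * (ν : ℝ)) * X * B12 ν := by
  have h := F1_ode ν
  simp only [B12, G, derivative_mul, derivative_ofNat, derivative_X, C_add, C_mul, C_1,
    show (C 2 : ℝ[X]) = 2 from rfl, show (C 4 : ℝ[X]) = 4 from rfl] at h ⊢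
  linear_combination (4 * X) * h

/-! ### The polynomial governing the turning points. -/

/-- Numerator of the logarithmic derivative of `xiSq`, up to sign the numerator of `D̂ / (y₀-4)`. -/
def turning (ν : ℕ) : ℝ[X] :=
  B12 ν * lam ν + C (2 * (ν : ℝ) - 1) * X * derivative (lam ν) * B12 ν -
    C (2 * (ν : ℝ) + 1) * X * derivative (B12 ν) * lam ν

/-- Derivatives enter `turning` only through X·B' and X·Λ', so multiplying by X-4 produces exactly
the left sides of the linear system. The right side is -B² D̂, a quadratic form in (B, G). -/
theorem turning_eq (ν : ℕ) :
    (X - 4) * turning ν = C ((2 * (ν : ℝ) - 1) ^ 2) * X * B12 ν ^ 2 -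
      (2 * B12 ν - C (2 * (ν : ℝ) + 1) * G ν) ^ 2 := by
  have h1 := B12_system ν
  have h2 := G_system ν
  have h3 : (2 : ℝ[X]) ≠ 0 := two_ne_zero
  apply mul_left_cancel₀ h3
  simp only [turning, lam_eq, derivative_sub, C_add, C_sub, C_mul, C_1, C_pow,
    show (C 2 : ℝ[X]) = 2 from rfl, show (C 4 : ℝ[X]) = 4 from rfl] at h1 h2 ⊢
  linear_combination (2 * (2 * C (ν : ℝ) - 1) * B12 ν - 2 * (2 * C (ν : ℝ) + 1) * (B12 ν - G ν)) * h1
    - (2 * C (ν : ℝ) - 1) * B12 ν * h2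

theorem eval_B12_system (ν : ℕ) (y : ℝ) :
    y * (y - 4) * (derivative (B12 ν)).eval y =
      ν * y * (B12 ν).eval y - (2 * ν + 1) * (G ν).eval y := by
  simpa using congrArg (eval y) (B12_system ν)

theorem eval_turning (ν : ℕ) (y : ℝ) :
    (y - 4) * (turning ν).eval y = (2 * (ν : ℝ) - 1) ^ 2 * y * (B12 ν).eval y ^ 2 -
      (2 * (B12 ν).eval y - (2 * ν + 1) * (G ν).eval y) ^ 2 := by
  simpa using congrArg (eval y) (turning_eq ν)

theorem turning_degree (ν : ℕ) (hν : 1 ≤ ν) : (turning ν).natDegree = 2 * ν := by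
  have hν' : (1 : ℝ) ≤ ν := by exact_mod_cast hν
  have hB := natDegree_B12_le ν
  have hG := natDegree_G_le ν
  have hne : (2 * (ν : ℝ) - 1) ^ 2 ≠ 0 := by
    have : 0 < 2 * (ν : ℝ) - 1 := by linarith
    positivity
  have h1 : (C ((2 * (ν : ℝ) - 1) ^ 2) * X * B12 ν ^ 2).natDegree = 2 * ν + 1 := by
    rw [mul_assoc, natDegree_C_mul hne, natDegree_X_mul ((B12_monic ν).pow 2).ne_zero,
      (B12_monic ν).natDegree_pow, natDegree_B12]
  have h2 : ((2 * B12 ν - C (2 * (ν : ℝ) + 1) * G ν) ^ 2).natDegree ≤ 2 * ν := by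
    refine natDegree_pow_le_of_le 2 ((natDegree_sub_le _ _).trans (max_le ?_ ?_))
    · exact (natDegree_C_mul_le 2 _).trans hB
    · exact (natDegree_C_mul_le _ _).trans hG
  have h3 := congrArg natDegree (turning_eq ν)
  rw [natDegree_sub_eq_left_of_natDegree_lt (by omega), h1] at h3
  have hq : turning ν ≠ 0 := by
    rintro h
    rw [h, mul_zero, natDegree_zero] at h3
    omega
  rw [show (X - 4 : ℝ[X]) = X - C 4 from rfl, natDegree_mul (X_sub_C_ne_zero 4) hq,
    natDegree_X_sub_C] at h3
  omega

/-! ### Real zeros of `B12` through an Appell sequence. -/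

/-- The Appell sequence of monic polynomials with exponential generating function
`J₀(2t) exp(st)`, defined by its three-term recurrence. -/
def appell : ℕ → ℝ[X]
  | 0 => 1
  | 1 => X
  | n + 2 => C ((2 * (n : ℝ) + 3) / (n + 2)) * X * appell (n + 1) -
      C (((n : ℝ) + 1) / (n + 2)) * (X ^ 2 + 4) * appell n

/-- This is Bonnet's recurrence for Legendre polynomials, homogenised by A_n(s) = (s²+4)^{n/2}
P_n(s/√(s²+4)). -/
theorem appell_rec (n : ℕ) : C ((n : ℝ) + 2) * appell (n + 2) =
    C (2 * (n : ℝ) + 3) * X * appell (n + 1) - C ((n : ℝ) + 1) * (X ^ 2 + 4) * appell n := by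
  have h : (n : ℝ) + 2 ≠ 0 := by positivity
  rw [appell, mul_sub, ← mul_assoc, ← mul_assoc, ← mul_assoc, ← mul_assoc, ← C_mul, ← C_mul,
    mul_div_cancel₀ _ h, mul_div_cancel₀ _ h]

/-- Differentiating the recurrence and inserting the two previous cases leaves a multiple of the
recurrence one index lower. The Appell property gives all coefficients from the constant terms and
ties A_n' to A_{n-1} in the interlacing argument. -/
theorem derivative_appell (n : ℕ) :
    derivative (appell (n + 1)) = C ((n : ℝ) + 1) * appell n := by
  induction n using Nat.twoStepInduction with
  | zero => simp [appell]
  | one =>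
    have h2 : (C 2 : ℝ[X]) ≠ 0 := by rw [Ne, C_eq_zero]; norm_num
    have h := congrArg derivative (appell_rec 0)
    apply mul_left_cancel₀ h2
    simp only [appell, derivative_mul, derivative_sub, derivative_C, derivative_X, derivative_add,
      derivative_X_pow, derivative_ofNat, derivative_one, Nat.cast_zero, zero_add, mul_zero,
      C_1, show (C 2 : ℝ[X]) = 2 from rfl, show (C 3 : ℝ[X]) = 3 from rfl, Nat.cast_one,
      one_add_one_eq_two, Nat.cast_ofNat] at h ⊢
    linear_combination h
  | more n h1 h2 =>
    have hn : (C ((n : ℝ) + 3) : ℝ[X]) ≠ 0 := by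
      rw [Ne, C_eq_zero]; positivity
    have e1 := appell_rec (n + 1)
    have e2 := appell_rec n
    have e := congrArg derivative e1
    simp only [derivative_mul, derivative_sub, derivative_C, derivative_X, derivative_add,
      derivative_X_pow, derivative_ofNat] at e
    rw [h1, h2] at e
    apply mul_left_cancel₀ hn
    push_cast at e e1 e2 ⊢
    simp only [C_add, C_mul, C_1, show (C 2 : ℝ[X]) = 2 from rfl,
      show (C 3 : ℝ[X]) = 3 from rfl] at e e1 e2 ⊢
    linear_combination e - (C (n : ℝ) + 2) * e2

theorem appell_natDegree_monic (n : ℕ) : (appell n).natDegree = n ∧ (appell n).Monic := by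
  suffices h : (appell n).natDegree ≤ n ∧ (appell n).coeff n = 1 by
    have hd := natDegree_eq_of_le_of_coeff_ne_zero h.1 (by rw [h.2]; exact one_ne_zero)
    exact ⟨hd, by rw [Monic, leadingCoeff, hd, h.2]⟩
  induction n with
  | zero => simp [appell]
  | succ n ih =>
    have hd := derivative_appell n
    have hc : ∀ m, (appell (n + 1)).coeff (m + 1) * (m + 1) = (n + 1) * (appell n).coeff m := by
      intro m
      have := congrArg (fun p => coeff p m) hd
      simpa only [coeff_derivative, coeff_C_mul] using this
    refine ⟨natDegree_le_iff_coeff_eq_zero.2 fun N hN => ?_, ?_⟩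
    · obtain ⟨m, rfl⟩ : ∃ m, N = m + 1 := ⟨N - 1, by omega⟩
      have := hc m
      rw [natDegree_le_iff_coeff_eq_zero.1 ih.1 m (by omega), mul_zero] at this
      exact (mul_eq_zero.1 this).resolve_right (by positivity)
    · have := hc n
      rw [ih.2] at this
      have hn : (n : ℝ) + 1 ≠ 0 := by positivity
      field_simp at this
      linarith

theorem eval_appell_neg (n : ℕ) (s : ℝ) :
    (appell n).eval (-s) = (-1) ^ n * (appell n).eval s := by
  induction n using Nat.twoStepInduction with
  | zero => simp [appell]
  | one => simp [appell]
  | more n h1 h2 =>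
    simp only [appell, eval_sub, eval_mul, eval_C, eval_X, eval_add, eval_pow, eval_ofNat, h1, h2]
    ring

theorem coeff_appell (n m : ℕ) :
    (appell n).coeff m = n.choose m * (appell (n - m)).coeff 0 := by
  induction m generalizing n with
  | zero => simp
  | succ m ih =>
    cases n with
    | zero => simp [appell, coeff_one]
    | succ k =>
      have := congrArg (fun p => coeff p m) (derivative_appell k)
      simp only [coeff_derivative, coeff_C_mul, ih] at this
      have hc : ((k + 1).choose (m + 1) : ℝ) * (m + 1) = (k + 1) * k.choose m := by
        exact_mod_cast (Nat.add_one_mul_choose_eq k m).symm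
      have hm : (m : ℝ) + 1 ≠ 0 := by positivity
      apply mul_right_cancel₀ hm
      rw [this, Nat.add_sub_add_right]
      linear_combination (-(appell (k - m)).coeff 0) * hc

theorem coeff_zero_appell_add_two (n : ℕ) :
    ((n : ℝ) + 2) * (appell (n + 2)).coeff 0 = -4 * (n + 1) * (appell n).coeff 0 := by
  have := congrArg (eval 0) (appell_rec n)
  simp only [eval_mul, eval_sub, eval_add, eval_C, eval_X, eval_pow, eval_ofNat,
    ← coeff_zero_eq_eval_zero] at this
  linear_combination this

theorem coeff_zero_appell_odd (k : ℕ) : (appell (2 * k + 1)).coeff 0 = 0 := by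
  induction k with
  | zero => simp [appell]
  | succ k ih =>
    have := coeff_zero_appell_add_two (2 * k + 1)
    rw [ih, mul_zero] at this
    exact (mul_eq_zero.1 this).resolve_left (by positivity)

theorem coeff_zero_appell_even (k : ℕ) :
    (appell (2 * k)).coeff 0 = (-1) ^ k * ((2 * k).factorial / (k.factorial : ℝ) ^ 2) := by
  induction k with
  | zero => simp [appell]
  | succ k ih =>
    have := coeff_zero_appell_add_two (2 * k)
    rw [ih] at this
    have h0 : ((2 * k : ℕ) : ℝ) + 2 ≠ 0 := by positivity
    apply mul_left_cancel₀ h0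
    rw [show 2 * (k + 1) = 2 * k + 2 by ring, this]
    simp only [Nat.factorial_succ (2 * k), Nat.factorial_succ (2 * k + 1), Nat.factorial_succ k]
    have h1 : (k.factorial : ℝ) ≠ 0 := by positivity
    push_cast
    field_simp
    ring

theorem coeff_B12_eq_choose (ν μ : ℕ) (h : μ ≤ ν) : (B12 ν).coeff μ =
    (2 * ν).choose (2 * μ) * ((2 * (ν - μ)).factorial / ((ν - μ).factorial : ℝ) ^ 2) := by
  obtain ⟨k, rfl⟩ : ∃ k, ν = μ + k := ⟨ν - μ, by omega⟩
  rw [coeff_B12, coeff_F1 _ _ h, Nat.cast_choose ℝ (by omega), Nat.add_sub_cancel_left,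
    show 2 * (μ + k) - 2 * μ = 2 * k by omega]
  simp only [Nat.factorial_succ (2 * (μ + k)), Nat.factorial_succ k]
  have h1 : (k.factorial : ℝ) ≠ 0 := by positivity
  have h2 : ((2 * k).factorial : ℝ) ≠ 0 := by positivity
  have h3 : ((2 * μ).factorial : ℝ) ≠ 0 := by positivity
  have h4 : 2 * ((μ : ℝ) + k) + 1 ≠ 0 := by positivity
  push_cast
  field_simp
  ring

/-- Coefficients of an Appell sequence are binomials times constant terms; the odd constant terms
vanish and the even ones are signed central binomials, matching `coeff_B12_eq_choose`. -/
theorem appell_two_mul (ν : ℕ) :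
    appell (2 * ν) = C ((-1) ^ ν) * expand ℝ 2 ((B12 ν).comp (C (-1) * X)) := by
  ext m
  rw [coeff_C_mul, coeff_expand two_pos, coeff_appell]
  split_ifs with h
  · obtain ⟨μ, rfl⟩ := h
    rw [Nat.mul_div_cancel_left _ two_pos, comp_C_mul_X_coeff]
    rcases le_or_gt μ ν with h | h
    · rw [coeff_B12_eq_choose _ _ h, ← Nat.mul_sub, coeff_zero_appell_even]
      have : (-1 : ℝ) ^ ν = (-1) ^ (ν - μ) * (-1) ^ μ := by
        rw [← pow_add, Nat.sub_add_cancel h]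
      have h2 : ((-1 : ℝ) ^ μ) * (-1) ^ μ = 1 := by
        rw [← mul_pow]; simp
      rw [this]
      linear_combination (-(-1 : ℝ) ^ (ν - μ) * ((2 * ν).choose (2 * μ) *
        ((2 * (ν - μ)).factorial / ((ν - μ).factorial : ℝ) ^ 2))) * h2
    · rw [Nat.choose_eq_zero_of_lt (by omega),
        coeff_eq_zero_of_natDegree_lt (p := B12 ν) (by rw [natDegree_B12]; exact h)]
      simp
  · rw [mul_zero]
    rcases le_or_gt m (2 * ν) with h' | h'
    · obtain ⟨k, hk⟩ : ∃ k, 2 * ν - m = 2 * k + 1 := ⟨(2 * ν - m) / 2, by omega⟩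
      rw [hk, coeff_zero_appell_odd, mul_zero]
    · rw [Nat.choose_eq_zero_of_lt h']
      simp

theorem eq_prod_of_monic_of_roots {K : Type*} [Field K] {n : ℕ} {p : K[X]} (hp : p.Monic)
    (hn : p.natDegree = n) (z : Fin n → K) (hz : Function.Injective z)
    (h : ∀ i, p.eval (z i) = 0) : p = ∏ i, (X - C (z i)) := by
  apply eq_of_monic_of_dvd_of_natDegree_le (monic_prod_of_monic _ _ fun i _ => monic_X_sub_C _) hp
  · refine Finset.prod_dvd_of_coprime ?_ fun i _ => dvd_iff_isRoot.2 (h i)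
    exact fun i _ j _ hij => pairwise_coprime_X_sub_C hz hij
  · rw [hn, natDegree_prod_of_monic _ _ fun i _ => monic_X_sub_C _]
    simp

theorem exists_strictMono_zeros_of_alternating {f : ℝ → ℝ} (hf : Continuous f) {m : ℕ}
    (w : ℕ → ℝ) (hw : ∀ i < m, w i < w (i + 1)) (hs : ∀ i < m, f (w i) * f (w (i + 1)) < 0) :
    ∃ z : Fin m → ℝ, StrictMono z ∧ ∀ i, f (z i) = 0 := by
  have key : ∀ i : Fin m, ∃ x ∈ Ioo (w i) (w (i + 1)), f x = 0 := by
    intro i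
    rcases mul_neg_iff.1 (hs i i.2) with h | h
    · exact intermediate_value_Ioo' (hw i i.2).le hf.continuousOn ⟨h.2, h.1⟩
    · exact intermediate_value_Ioo (hw i i.2).le hf.continuousOn ⟨h.1, h.2⟩
  choose z hz hz0 using key
  refine ⟨z, ?_, hz0⟩
  cases m with
  | zero => exact fun i => i.elim0
  | succ m =>
    refine Fin.strictMono_iff_lt_succ.2 fun i => (hz i.castSucc).2.trans ?_
    simpa using (hz i.succ).1

/-- The product is the derivative of ∏(X - z_k) at z_i, and n-1-i of its factors are negative. -/
theorem prod_sub_sign {n : ℕ} (z : Fin n → ℝ) (hz : StrictMono z) (i : Fin n) :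
    0 < (-1) ^ (n + 1 + i : ℕ) * ∏ k ∈ Finset.univ.erase i, (z i - z k) := by
  have hu : Finset.univ.erase i = Finset.Iio i ∪ Finset.Ioi i := by
    ext k; simp [lt_or_lt_iff_ne]
  have hd : Disjoint (Finset.Iio i) (Finset.Ioi i) := by
    rw [Finset.disjoint_left]
    intro k h1 h2
    simp at h1 h2
    exact absurd h1 h2.not_gt
  rw [hu, Finset.prod_union hd]
  have h1 : 0 < ∏ k ∈ Finset.Iio i, (z i - z k) :=
    Finset.prod_pos fun k hk => sub_pos.2 (hz (Finset.mem_Iio.1 hk))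
  have h2 : 0 < ∏ k ∈ Finset.Ioi i, (z k - z i) :=
    Finset.prod_pos fun k hk => sub_pos.2 (hz (Finset.mem_Ioi.1 hk))
  have h3 : ∏ k ∈ Finset.Ioi i, (z i - z k) =
      (-1) ^ (n - 1 - i : ℕ) * ∏ k ∈ Finset.Ioi i, (z k - z i) := by
    rw [← Fin.card_Ioi, ← Finset.prod_const, ← Finset.prod_mul_distrib]
    exact Finset.prod_congr rfl fun k _ => by ring
  have h4 : (-1 : ℝ) ^ (n + 1 + i : ℕ) * (-1) ^ (n - 1 - i : ℕ) = 1 := by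
    rw [← pow_add, show n + 1 + (i : ℕ) + (n - 1 - i) = 2 * n by omega, pow_mul]
    simp
  rw [h3]
  calc (0 : ℝ) < (∏ k ∈ Finset.Iio i, (z i - z k)) * ∏ k ∈ Finset.Ioi i, (z k - z i) :=
        mul_pos h1 h2
    _ = _ := by
      linear_combination (-(∏ k ∈ Finset.Iio i, (z i - z k)) *
        ∏ k ∈ Finset.Ioi i, (z k - z i)) * h4

/-- At a zero of A_n the middle term of the recurrence drops out. As s²+4 > 0, A_{n+1} there has the
sign opposite to A_{n-1}, hence opposite to A_n' = n A_{n-1}. It therefore alternates along the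
zeros of A_n, and its signs at ±∞ supply the two outer sign changes. -/
theorem exists_strictMono_zeros_appell (n : ℕ) :
    ∃ z : Fin n → ℝ, StrictMono z ∧ ∀ i, (appell n).eval (z i) = 0 := by
  induction n with
  | zero => exact ⟨Fin.elim0, fun i => i.elim0, fun i => i.elim0⟩
  | succ n ih =>
    obtain ⟨z, hz, hz0⟩ := ih
    have hprod := eq_prod_of_monic_of_roots (appell_natDegree_monic n).2
      (appell_natDegree_monic n).1 z hz.injective hz0
    -- the next polynomial alternates in sign at the zeros
    have hsign : ∀ i : Fin n, 0 < (-1) ^ (n + i : ℕ) * (appell (n + 1)).eval (z i) := by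
      intro i
      obtain ⟨m, rfl⟩ : ∃ m, n = m + 1 := ⟨n - 1, by have := i.2; omega⟩
      have hd : (derivative (appell (m + 1))).eval (z i) =
          ∏ k ∈ Finset.univ.erase i, (z i - z k) := by
        rw [hprod, derivative_prod_finset, eval_finsetSum, Finset.sum_eq_single i]
        · simp [eval_prod]
        · intro b _ hb
          rw [eval_mul, eval_prod, Finset.prod_eq_zero (i := i)] <;> simp [Ne.symm hb]
        · simp
      rw [derivative_appell, eval_mul, eval_C] at hd
      have hr := congrArg (eval (z i)) (appell_rec m)
      simp only [eval_mul, eval_sub, eval_add, eval_C, eval_X, eval_pow, eval_ofNat, hz0] at hr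
      have hp := prod_sub_sign z hz i
      rw [← hd] at hp
      have h2 : (0 : ℝ) < (m : ℝ) + 2 := by positivity
      have h3 : 0 < (z i ^ 2 + 4) := by positivity
      have h4 := mul_pos hp h3
      rw [← mul_pos_iff_of_pos_left h2]
      calc _ < _ := h4
        _ = _ := by
          rw [show m + 1 + 1 + (i : ℕ) = (m + 1 + i) + 1 by ring, pow_succ]
          linear_combination (-(-1 : ℝ) ^ (m + 1 + i : ℕ)) * hr
    obtain ⟨M, hM0, hMz, hMpos⟩ : ∃ M : ℝ, 0 < M ∧ (∀ i, |z i| < M) ∧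
        0 < (appell (n + 1)).eval M := by
      have ht : Tendsto (fun x => (appell (n + 1)).eval x) atTop atTop := by
        apply tendsto_atTop_of_leadingCoeff_nonneg
        · rw [degree_eq_natDegree (appell_natDegree_monic _).2.ne_zero,
            (appell_natDegree_monic _).1]
          exact_mod_cast Nat.succ_pos n
        · rw [(appell_natDegree_monic _).2]
          exact zero_le_one
      exact ((eventually_gt_atTop 0).and ((eventually_all.2 fun i => eventually_gt_atTop |z i|).and
        (ht.eventually_gt_atTop 0))).exists
    -- The n+2 sample points -M, z₀, …, z_{n-1}, M bound n+1 intervals, each with a sign change.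
    let w : ℕ → ℝ := fun i => if i = 0 then -M else if h : i - 1 < n then z ⟨i - 1, h⟩ else M
    have hw : ∀ i < n + 1, w i < w (i + 1) := by
      intro i hi
      simp only [w, Nat.add_sub_cancel, Nat.succ_ne_zero, if_false]
      split_ifs with h1 h2 h2 h3 h3
      · exact (abs_lt.1 (hMz _)).1
      · linarith
      · exact hz (by rw [Fin.lt_def]; show i - 1 < i; omega)
      · exact (abs_lt.1 (hMz _)).2
      · omega
      · omega
    have hws : ∀ i ≤ n + 1, 0 < (-1) ^ (n + 1 + i : ℕ) * (appell (n + 1)).eval (w i) := by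
      intro i hi
      simp only [w]
      split_ifs with h1 h2
      · subst h1
        rw [eval_appell_neg, ← mul_assoc, ← pow_add, Even.neg_one_pow ⟨n + 1, by ring⟩]
        simpa using hMpos
      · have := hsign ⟨i - 1, h2⟩
        rwa [show n + 1 + i = (n + (i - 1)) + 2 by omega, pow_add, neg_one_sq, mul_one]
      · rw [Even.neg_one_pow ⟨n + 1, by omega⟩]
        simpa using hMpos
    refine exists_strictMono_zeros_of_alternating (appell (n + 1)).continuous w hw fun i hi => ?_
    have h1 := hws i hi.le
    have h2 := hws (i + 1) hi
    have h3 := mul_pos h1 h2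
    have h4 : (-1 : ℝ) ^ (n + 1 + i) * (-1) ^ (n + 1 + i) = 1 := by
      rw [← mul_pow]; simp
    rw [← add_assoc, pow_succ] at h3
    have h5 : (-1 : ℝ) ^ (n + 1 + i) * (appell (n + 1)).eval (w i) *
        ((-1) ^ (n + 1 + i) * -1 * (appell (n + 1)).eval (w (i + 1))) =
        -((appell (n + 1)).eval (w i) * (appell (n + 1)).eval (w (i + 1))) := by
      linear_combination (-(appell (n + 1)).eval (w i) * (appell (n + 1)).eval (w (i + 1))) * h4
    linarith

/-- `B12` has `ν` distinct real zeros, all negative. -/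
theorem exists_zeros_B12 (ν : ℕ) : ∃ a : Fin ν → ℝ, StrictMono a ∧ (∀ i, a i < 0) ∧
    B12 ν = ∏ i, (X - C (a i)) := by
  obtain ⟨z, hz, hz0⟩ := exists_strictMono_zeros_appell (2 * ν)
  have hB : ∀ i, (B12 ν).eval (-(z i) ^ 2) = 0 := by
    intro i
    have := hz0 i
    rw [appell_two_mul] at this
    simpa [expand_eval] using this
  let S := Finset.univ.image z
  have hS : S.card = 2 * ν := by
    rw [Finset.card_image_of_injective _ hz.injective]; simp
  have hsub : S.image (fun s => -s ^ 2) ⊆ (B12 ν).roots.toFinset := by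
    intro y hy
    simp only [S, Finset.mem_image, Finset.mem_univ, true_and] at hy
    obtain ⟨_, ⟨i, rfl⟩, rfl⟩ := hy
    rw [Multiset.mem_toFinset, mem_roots (B12_monic ν).ne_zero]
    exact hB i
  -- The map s ↦ -s² is at most two-to-one, so 2ν zeros in s give at least ν zeros of `B12`, which
  -- has degree ν.
  have hle : S.card ≤ 2 * (S.image (fun s => -s ^ 2)).card := by
    refine Finset.card_le_mul_card_image S 2 fun y hy => ?_
    obtain ⟨x, _, rfl⟩ := Finset.mem_image.1 hy
    refine (Finset.card_le_card (t := {x, -x}) fun t ht => ?_).trans Finset.card_le_two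
    have : t ^ 2 = x ^ 2 := by simpa using (Finset.mem_filter.1 ht).2
    simpa using sq_eq_sq_iff_eq_or_eq_neg.1 this
  have hcard : (B12 ν).roots.toFinset.card = ν := by
    apply le_antisymm
    · exact (Multiset.toFinset_card_le _).trans ((card_roots' _).trans (natDegree_B12_le ν))
    · have := Finset.card_le_card hsub
      omega
  let a := (B12 ν).roots.toFinset.orderEmbOfFin hcard
  have ha : ∀ i, (B12 ν).eval (a i) = 0 := by
    intro i
    have := Finset.orderEmbOfFin_mem _ hcard i
    rw [Multiset.mem_toFinset, mem_roots (B12_monic ν).ne_zero] at this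
    exact this
  refine ⟨a, a.strictMono, fun i => ?_, ?_⟩
  · by_contra! h
    exact (eval_B12_pos ν h).ne' (ha i)
  · exact eq_prod_of_monic_of_roots (B12_monic ν) (natDegree_B12 ν) a a.injective ha

/-! ### The factor `E` in ζ = √y₀: its equation, zeros and signs. -/

theorem eval_G_nonneg (ν : ℕ) {y : ℝ} (hy : 0 ≤ y) : 0 ≤ (G ν).eval y := by
  rw [eval_eq_sum_range' (Nat.lt_succ_of_le (natDegree_G_le ν))]
  refine Finset.sum_nonneg fun i hi => ?_
  have h1 := (coeff_F1_pos ν i (by simpa [Nat.lt_succ_iff] using hi)).le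
  rw [coeff_G]
  positivity

/-- Coefficientwise this is i ≤ ν(ν+1-i), that is (ν+1)(ν-i) ≥ 0, with equality at the leading term.
-/
theorem eval_G_le (ν : ℕ) {y : ℝ} (hy : 0 ≤ y) : (G ν).eval y ≤ 2 * ν * (B12 ν).eval y := by
  rw [eval_eq_sum_range' (Nat.lt_succ_of_le (natDegree_G_le ν)),
    eval_eq_sum_range' (Nat.lt_succ_of_le (natDegree_B12_le ν)), Finset.mul_sum]
  refine Finset.sum_le_sum fun i hi => ?_
  have hi' : i ≤ ν := by simpa [Nat.lt_succ_iff] using hi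
  have h1 := (coeff_F1_pos ν i hi').le
  have h2 : (i : ℝ) ≤ ν := by exact_mod_cast hi'
  rw [coeff_G, coeff_B12, ← mul_assoc]
  refine mul_le_mul_of_nonneg_right ?_ (pow_nonneg hy i)
  rw [← mul_assoc]
  refine mul_le_mul_of_nonneg_right ?_ h1
  nlinarith [mul_nonneg (Nat.cast_nonneg (α := ℝ) ν) (sub_nonneg.2 h2)]

/-- `B̂₁₂ d̂₊` as a polynomial in `ζ = y₀^{1/2}`; its value at `-ζ` is `B̂₁₂ d̂₋`. -/
def E (ν : ℕ) : ℝ[X] :=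
  2 * (B12 ν).comp (X ^ 2) - C (2 * (ν : ℝ) + 1) * (G ν).comp (X ^ 2) +
    C (2 * (ν : ℝ) - 1) * X * (B12 ν).comp (X ^ 2)

theorem eval_E (ν : ℕ) (x : ℝ) : (E ν).eval x =
    2 * (B12 ν).eval (x ^ 2) - (2 * ν + 1) * (G ν).eval (x ^ 2) +
      (2 * ν - 1) * x * (B12 ν).eval (x ^ 2) := by
  simp [E]

/-- The particular combination of B and G in `E` decouples the system: the remaining inhomogeneity
involves only B(x²), which is positive for real x. -/
theorem E_ode (ν : ℕ) : (X ^ 2 - 4) * derivative (E ν) =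
    (C (2 * (ν : ℝ) + 2) * X + C (2 * (2 * (ν : ℝ) - 1))) * E ν -
      C (2 * (ν : ℝ) - 1) * (X - 4) * (X - 2) * (B12 ν).comp (X ^ 2) := by
  have h1 := congrArg (fun p => p.comp (X ^ 2)) (B12_system ν)
  have h2 := congrArg (fun p => p.comp (X ^ 2)) (G_system ν)
  simp only [mul_comp, sub_comp, add_comp, X_comp, C_comp, ofNat_comp] at h1 h2
  apply mul_left_cancel₀ (X_ne_zero (R := ℝ))
  simp only [E, derivative_sub, derivative_add, derivative_mul, derivative_comp, derivative_X_pow,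
    derivative_X, derivative_C, derivative_ofNat]
  simp only [C_add, C_sub, C_mul, C_1, show (C 2 : ℝ[X]) = 2 from rfl,
    show (C 4 : ℝ[X]) = 4 from rfl, Nat.cast_ofNat] at h1 h2 ⊢
  linear_combination (4 + 2 * X * (2 * C (ν : ℝ) - 1)) * h1 - (2 * C (ν : ℝ) + 1) * h2

theorem eval_E_ode (ν : ℕ) (x : ℝ) : (x ^ 2 - 4) * (derivative (E ν)).eval x =
    ((2 * ν + 2) * x + 2 * (2 * ν - 1)) * (E ν).eval x -
      (2 * ν - 1) * (x - 4) * (x - 2) * (B12 ν).eval (x ^ 2) := by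
  simpa using congrArg (eval x) (E_ode ν)

/-- At the singular point x = 2 both E' and the forcing drop out of the equation. This zero is the
source of the factor y₀-4 in D̂. -/
theorem eval_E_two (ν : ℕ) : (E ν).eval 2 = 0 := by
  have h := eval_E_ode ν 2
  have h2 : (8 * (ν : ℝ) + 2) * (E ν).eval 2 = 0 := by linear_combination -h
  exact (mul_eq_zero.1 h2).resolve_left (by positivity)

theorem eval_derivative_E_two (ν : ℕ) :
    (4 * (ν : ℝ) - 1) * (derivative (E ν)).eval 2 = -(2 * ν - 1) * (B12 ν).eval 4 := by
  have h := congrArg (fun p => (derivative p).eval 2) (E_ode ν)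
  simp only [derivative_sub, derivative_add, derivative_mul, derivative_X_pow, derivative_X,
    derivative_C, derivative_ofNat, eval_mul, eval_add, eval_sub, eval_pow, eval_X, eval_C,
    eval_ofNat, eval_zero, eval_one, eval_E_two, eval_comp, Nat.cast_ofNat] at h
  norm_num at h
  linear_combination (-1 / 2) * h

theorem turning_comp_sq (ν : ℕ) :
    (X ^ 2 - 4) * (turning ν).comp (X ^ 2) = -(E ν * (E ν).comp (-X)) := by
  have h := congrArg (fun p => p.comp (X ^ 2)) (turning_eq ν)
  simp only [mul_comp, sub_comp, pow_comp, X_comp, C_comp, ofNat_comp, C_pow,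
    Nat.cast_ofNat] at h
  rw [h, E]
  simp only [mul_comp, sub_comp, add_comp, C_comp, X_comp, ofNat_comp, comp_assoc, pow_comp,
    neg_sq, Nat.cast_ofNat]
  ring

theorem eval_turning_sq (ν : ℕ) (x : ℝ) :
    (x ^ 2 - 4) * (turning ν).eval (x ^ 2) = -((E ν).eval x * (E ν).eval (-x)) := by
  simpa using congrArg (eval x) (turning_comp_sq ν)

theorem eval_derivative_turning_sq (ν : ℕ) (x : ℝ) :
    2 * x * (turning ν).eval (x ^ 2) +
      (x ^ 2 - 4) * (2 * x * (derivative (turning ν)).eval (x ^ 2)) =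
    -((derivative (E ν)).eval x * (E ν).eval (-x) -
      (E ν).eval x * (derivative (E ν)).eval (-x)) := by
  have h := congrArg (fun p => (derivative p).eval x) (turning_comp_sq ν)
  simp only [derivative_sub, derivative_mul, derivative_X_pow, derivative_neg, derivative_comp,
    derivative_X, derivative_ofNat, eval_mul, eval_add, eval_sub, eval_pow, eval_X, eval_C,
    eval_ofNat, eval_zero, eval_one, eval_comp, eval_neg, Nat.cast_ofNat] at h
  linear_combination h

/-- Integrating factor for the linear equation satisfied by `E`. -/
def intFactor (ν : ℕ) (x : ℝ) : ℝ :=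
  Real.exp (-((2 * ν + 1 / 2) * Real.log (x - 2) + 3 / 2 * Real.log (x + 2)))

theorem intFactor_pos (ν : ℕ) (x : ℝ) : 0 < intFactor ν x := Real.exp_pos _

theorem hasDerivAt_E_mul_intFactor (ν : ℕ) {x : ℝ} (h1 : x ≠ 2) (h2 : x ≠ -2) :
    HasDerivAt (fun x => (E ν).eval x * intFactor ν x)
      ((2 * ν - 1) * (B12 ν).eval (x ^ 2) * intFactor ν x * ((4 - x) / (x + 2))) x := by
  have h1' : x - 2 ≠ 0 := sub_ne_zero.2 h1
  have h2' : x + 2 ≠ 0 := fun h => h2 (by linarith)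
  -- `Real.log` is log|·|, so one formula serves on every side of ±2. The exponents 2ν+1/2 and 3/2
  -- are the residues at 2 and -2 of the coefficient of `E` in the equation divided by x²-4.
  have hl1 : HasDerivAt (fun x => Real.log (x - 2)) (1 / (x - 2)) x :=
    ((hasDerivAt_id x).sub_const 2).log h1'
  have hl2 : HasDerivAt (fun x => Real.log (x + 2)) (1 / (x + 2)) x :=
    ((hasDerivAt_id x).add_const 2).log h2'
  have hm := ((hl1.const_mul (2 * (ν : ℝ) + 1 / 2)).add (hl2.const_mul (3 / 2 : ℝ))).neg.exp
  have hE := ((E ν).hasDerivAt x).mul hm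
  refine hE.congr_deriv ?_
  have hode := eval_E_ode ν x
  have hd : (derivative (E ν)).eval x = (((2 * ν + 2) * x + 2 * (2 * ν - 1)) * (E ν).eval x -
      (2 * ν - 1) * (x - 4) * (x - 2) * (B12 ν).eval (x ^ 2)) / ((x - 2) * (x + 2)) := by
    rw [eq_div_iff (mul_ne_zero h1' h2'), ← hode]
    ring
  rw [hd]
  simp only [intFactor, Pi.add_apply, Pi.neg_apply]
  field_simp
  ring

theorem strictMonoOn_E_mul_intFactor (ν : ℕ) (hν : 1 ≤ ν) {D : Set ℝ} (hD : Convex ℝ D)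
    (h1 : ∀ x ∈ D, x ≠ 2) (h2 : ∀ x ∈ D, x ≠ -2)
    (hs : ∀ x ∈ interior D, 0 < (4 - x) / (x + 2)) :
    StrictMonoOn (fun x => (E ν).eval x * intFactor ν x) D := by
  have hν' : (1 : ℝ) ≤ ν := by exact_mod_cast hν
  refine strictMonoOn_of_deriv_pos hD (fun x hx =>
    (hasDerivAt_E_mul_intFactor ν (h1 x hx) (h2 x hx)).continuousAt.continuousWithinAt)
    fun x hx => ?_
  have hx' := interior_subset hx
  rw [(hasDerivAt_E_mul_intFactor ν (h1 x hx') (h2 x hx')).deriv]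
  have a1 := eval_B12_pos ν (sq_nonneg x)
  have a2 := intFactor_pos ν x
  have a3 : 0 < 2 * (ν : ℝ) - 1 := by linarith
  have a4 := hs x hx
  positivity

theorem strictAntiOn_E_mul_intFactor (ν : ℕ) (hν : 1 ≤ ν) :
    StrictAntiOn (fun x => (E ν).eval x * intFactor ν x) (Ici 4) := by
  have hν' : (1 : ℝ) ≤ ν := by exact_mod_cast hν
  have h1 : ∀ x ∈ Ici (4 : ℝ), x ≠ 2 := fun x hx => by
    have : (4 : ℝ) ≤ x := hx
    exact (by linarith : (2 : ℝ) < x).ne'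
  have h2 : ∀ x ∈ Ici (4 : ℝ), x ≠ -2 := fun x hx => by
    have : (4 : ℝ) ≤ x := hx
    exact (by linarith : (-2 : ℝ) < x).ne'
  refine strictAntiOn_of_deriv_neg (convex_Ici 4) (fun x hx =>
    (hasDerivAt_E_mul_intFactor ν (h1 x hx) (h2 x hx)).continuousAt.continuousWithinAt)
    fun x hx => ?_
  rw [interior_Ici] at hx
  have hx4 : (4 : ℝ) < x := hx
  rw [(hasDerivAt_E_mul_intFactor ν (h1 x hx4.le) (h2 x hx4.le)).deriv]
  have a1 := eval_B12_pos ν (sq_nonneg x)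
  have a2 := intFactor_pos ν x
  have a3 : 0 < 2 * (ν : ℝ) - 1 := by linarith
  exact mul_neg_of_pos_of_neg (by positivity) (div_neg_of_neg_of_pos (by linarith) (by linarith))

theorem eval_E_neg (ν : ℕ) (hν : 1 ≤ ν) {x : ℝ} (hx : x < -2) : (E ν).eval x < 0 := by
  have hν' : (1 : ℝ) ≤ ν := by exact_mod_cast hν
  rw [eval_E]
  have a1 := eval_B12_pos ν (sq_nonneg x)
  have a2 := eval_G_nonneg ν (sq_nonneg x)
  have a3 : 0 < -2 - (2 * (ν : ℝ) - 1) * x := by nlinarith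
  nlinarith [mul_pos a3 a1, mul_nonneg (Nat.cast_nonneg (α := ℝ) ν) a2]

theorem eval_E_neg_two (ν : ℕ) (hν : 1 ≤ ν) : (E ν).eval (-2) < 0 := by
  have hν' : (1 : ℝ) ≤ ν := by exact_mod_cast hν
  have h := eval_E_ode ν (-2)
  have a1 := eval_B12_pos ν (sq_nonneg (-2))
  have a3 : 0 < 2 * (ν : ℝ) - 1 := by linarith
  nlinarith [mul_pos a3 a1]

theorem eval_E_zero_pos (ν : ℕ) : 0 < (E ν).eval 0 := by
  rw [eval_E]
  have a1 := eval_B12_pos ν (sq_nonneg 0)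
  have : (G ν).eval (0 ^ 2) = 0 := by simp [G]
  rw [this]
  linarith

/-- Beyond 4 the product of E and the integrating factor decreases, so E could never recover from a
nonpositive value; but E is positive far out. -/
theorem eval_E_pos_of_ge (ν : ℕ) (hν : 1 ≤ ν) {x : ℝ} (hx : 4 ≤ x) : 0 < (E ν).eval x := by
  have hν' : (1 : ℝ) ≤ ν := by exact_mod_cast hν
  by_contra! h
  -- Chosen so that (2ν-1)t ≥ (2ν+1)·2ν, which by `eval_G_le` makes the linear term of E dominate
  -- the G-term.
  set t := x + (2 * ν + 1) * (2 * ν) with ht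
  have hpos : 0 < (2 * (ν : ℝ) + 1) * (2 * ν) := by positivity
  have h1 := strictAntiOn_E_mul_intFactor ν hν (show x ∈ Ici (4 : ℝ) from hx)
    (show t ∈ Ici (4 : ℝ) by rw [mem_Ici]; linarith) (by linarith)
  have h2 : (E ν).eval x * intFactor ν x ≤ 0 :=
    mul_nonpos_of_nonpos_of_nonneg h (intFactor_pos ν x).le
  have h3 : (E ν).eval t < 0 := by
    by_contra! h'
    exact absurd (mul_nonneg h' (intFactor_pos ν t).le) (not_le.2 (h1.trans_le h2))
  rw [eval_E] at h3
  have a1 := eval_B12_pos ν (sq_nonneg t)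
  have a2 := eval_G_le ν (sq_nonneg t)
  have a3 : 0 ≤ (2 * (ν : ℝ) - 1) * t - (2 * ν + 1) * (2 * ν) := by nlinarith
  have a4 : (2 * (ν : ℝ) + 1) * (G ν).eval (t ^ 2) ≤
      (2 * ν + 1) * (2 * ν * (B12 ν).eval (t ^ 2)) :=
    mul_le_mul_of_nonneg_left a2 (by positivity)
  nlinarith [mul_nonneg a3 a1.le]

theorem sign_of_mul_intFactor_lt {ν : ℕ} {x x' : ℝ}
    (h : (E ν).eval x * intFactor ν x < (E ν).eval x' * intFactor ν x') :
    (0 ≤ (E ν).eval x → 0 < (E ν).eval x') ∧ ((E ν).eval x' ≤ 0 → (E ν).eval x < 0) := by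
  have h1 := intFactor_pos ν x
  have h2 := intFactor_pos ν x'
  constructor
  · intro h3
    exact pos_of_mul_pos_left ((mul_nonneg h3 h1.le).trans_lt h) h2.le
  · intro h3
    by_contra! h4
    exact absurd (h.trans_le (mul_nonpos_of_nonpos_of_nonneg h3 h2.le))
      (not_lt.2 (mul_nonneg h4 h1.le))

/-- The zeros and signs of `E` on `(-2, 2)`. -/
theorem exists_zero_E_left (ν : ℕ) (hν : 1 ≤ ν) : ∃ x, 0 < x ∧ x < 2 ∧ (E ν).eval (-x) = 0 ∧
    (∀ t, -2 ≤ t → t < -x → (E ν).eval t < 0) ∧ (∀ t, -x < t → t < 2 → 0 < (E ν).eval t) := by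
  have hmono : StrictMonoOn (fun x => (E ν).eval x * intFactor ν x) (Ioo (-2) 2) := by
    refine strictMonoOn_E_mul_intFactor ν hν (convex_Ioo _ _) (fun x hx => hx.2.ne)
      (fun x hx => hx.1.ne') fun x hx => ?_
    rw [interior_Ioo] at hx
    exact div_pos (by linarith [hx.2]) (by linarith [hx.1])
  obtain ⟨z, hz, hz0⟩ := intermediate_value_Ioo (show (-2 : ℝ) ≤ 0 by norm_num)
    (E ν).continuous.continuousOn ⟨eval_E_neg_two ν hν, eval_E_zero_pos ν⟩
  simp only at hz0
  have hz1 := hz.1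
  have hz2 := hz.2
  refine ⟨-z, by linarith, by linarith, by rwa [neg_neg], fun t h1 h2 => ?_, fun t h1 h2 => ?_⟩
  · rw [neg_neg] at h2
    rcases h1.eq_or_lt with h1 | h1
    · exact h1 ▸ eval_E_neg_two ν hν
    · exact (sign_of_mul_intFactor_lt (hmono ⟨h1, by linarith⟩ ⟨hz1, by linarith⟩ h2)).2 hz0.le
  · rw [neg_neg] at h1
    exact (sign_of_mul_intFactor_lt (hmono ⟨hz1, by linarith⟩ ⟨by linarith, h2⟩ h1)).1 hz0.ge

theorem eval_derivative_E_two_neg (ν : ℕ) (hν : 1 ≤ ν) : (derivative (E ν)).eval 2 < 0 := by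
  have hν' : (1 : ℝ) ≤ ν := by exact_mod_cast hν
  have h := eval_derivative_E_two ν
  have a1 := eval_B12_pos ν (show (0 : ℝ) ≤ 4 by norm_num)
  by_contra! h'
  have a3 : 0 < 2 * (ν : ℝ) - 1 := by linarith
  have a4 : 0 < 4 * (ν : ℝ) - 1 := by linarith
  nlinarith [mul_pos a3 a1, mul_nonneg a4.le h']

/-- The zeros and signs of `E` on `(2, ∞)`. -/
theorem exists_zero_E_right (ν : ℕ) (hν : 1 ≤ ν) : ∃ x, 2 < x ∧ x < 4 ∧ (E ν).eval x = 0 ∧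
    (∀ t, 2 < t → t < x → (E ν).eval t < 0) ∧ (∀ t, x < t → 0 < (E ν).eval t) := by
  have hmono : StrictMonoOn (fun x => (E ν).eval x * intFactor ν x) (Ioc 2 4) := by
    refine strictMonoOn_E_mul_intFactor ν hν (convex_Ioc _ _) (fun x hx => hx.1.ne')
      (fun x hx => (by linarith [hx.1] : (-2 : ℝ) < x).ne') fun x hx => ?_
    rw [interior_Ioc] at hx
    exact div_pos (by linarith [hx.2]) (by linarith [hx.1])
  obtain ⟨x₁, h12, h14, h1⟩ : ∃ x₁, 2 < x₁ ∧ x₁ < 4 ∧ (E ν).eval x₁ < 0 := by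
    -- The integrating factor is singular at 2, so the negative sign just to its right comes from
    -- E(2) = 0 and E'(2) < 0.
    have hs := (hasDerivAt_iff_tendsto_slope.1 ((E ν).hasDerivAt 2)).eventually_lt_const
      (eval_derivative_E_two_neg ν hν)
    have hs' : ∀ᶠ x in 𝓝[>] (2 : ℝ), slope (fun x => (E ν).eval x) 2 x < 0 :=
      hs.filter_mono (nhdsWithin_mono _ fun x hx => ne_of_gt hx)
    obtain ⟨x, hx, hx2⟩ := (hs'.and (Ioo_mem_nhdsGT (show (2 : ℝ) < 4 by norm_num))).exists
    refine ⟨x, hx2.1, hx2.2, ?_⟩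
    rw [slope_def_field, eval_E_two, sub_zero] at hx
    have : 0 < x - 2 := by linarith [hx2.1]
    rcases div_neg_iff.1 hx with h | h
    · linarith [h.2]
    · exact h.1
  obtain ⟨z, hz, hz0⟩ := intermediate_value_Ioo h14.le
    (E ν).continuous.continuousOn ⟨h1, eval_E_pos_of_ge ν hν le_rfl⟩
  simp only at hz0
  have hz1 := hz.1
  have hz2 := hz.2
  refine ⟨z, by linarith, by linarith, hz0, fun t h1 h2 => ?_, fun t h1 => ?_⟩
  · exact (sign_of_mul_intFactor_lt
      (hmono ⟨h1, by linarith⟩ ⟨by linarith, hz2.le⟩ h2)).2 hz0.le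
  · rcases le_or_gt 4 t with h4 | h4
    · exact eval_E_pos_of_ge ν hν h4
    · exact (sign_of_mul_intFactor_lt
        (hmono ⟨by linarith, hz2.le⟩ ⟨by linarith, h4.le⟩ h1)).1 hz0.ge

/-! ### Signs of `turning` on the real line. -/

theorem derivative_B12_ne_zero {ν : ℕ} {y : ℝ} (h : (B12 ν).eval y = 0) :
    (derivative (B12 ν)).eval y ≠ 0 := by
  obtain ⟨a, ha, -, hB⟩ := exists_zeros_B12 ν
  have hs : (B12 ν).Separable := by
    rw [hB]
    exact separable_prod_X_sub_C_iff.2 ha.injective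
  exact hs.eval₂_derivative_ne_zero (RingHom.id ℝ) h

theorem neg_of_eval_B12 {ν : ℕ} {y : ℝ} (h : (B12 ν).eval y = 0) : y < 0 := by
  by_contra! h'
  exact (eval_B12_pos ν h').ne' h

/-- A common zero would be negative, hence not a singular point of the system, and would force B' =
0 against the simplicity of the zeros. -/
theorem eval_G_ne_zero {ν : ℕ} {y : ℝ} (h : (B12 ν).eval y = 0) : (G ν).eval y ≠ 0 := by
  intro hG
  have h1 := eval_B12_system ν y
  have hy := neg_of_eval_B12 h
  rw [h, hG, mul_zero, mul_zero, sub_zero] at h1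
  exact (mul_ne_zero (mul_ne_zero hy.ne (by linarith)) (derivative_B12_ne_zero h)) h1

theorem eval_turning_pos_of_nonpos (ν : ℕ) {y : ℝ} (hy : y ≤ 0) (hν : 1 ≤ ν) :
    0 < (turning ν).eval y := by
  have hν' : (1 : ℝ) ≤ ν := by exact_mod_cast hν
  have h := eval_turning ν y
  have key : 0 < -((2 * (ν : ℝ) - 1) ^ 2 * y * (B12 ν).eval y ^ 2) +
      (2 * (B12 ν).eval y - (2 * ν + 1) * (G ν).eval y) ^ 2 := by
    have h1 : 0 ≤ -((2 * (ν : ℝ) - 1) ^ 2 * y * (B12 ν).eval y ^ 2) := by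
      have : 0 ≤ (2 * (ν : ℝ) - 1) ^ 2 * (-y) * (B12 ν).eval y ^ 2 := by
        have : 0 ≤ -y := by linarith
        positivity
      linarith
    by_cases hB : (B12 ν).eval y = 0
    · have := eval_G_ne_zero hB
      rw [hB]
      have h2 : 0 < (2 * 0 - (2 * (ν : ℝ) + 1) * (G ν).eval y) ^ 2 := by
        rw [mul_zero, zero_sub, neg_sq]
        positivity
      simpa using h2
    · rcases hy.eq_or_lt with rfl | hy
      · have : (G ν).eval 0 = 0 := by simp [G]
        rw [this]
        have : 0 < (2 * (B12 ν).eval 0 - (2 * (ν : ℝ) + 1) * 0) ^ 2 := by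
          rw [mul_zero, sub_zero]
          have h0 := eval_B12_pos ν (le_refl 0)
          positivity
        simpa using this
      · have h3 : 0 < (2 * (ν : ℝ) - 1) ^ 2 * (-y) * (B12 ν).eval y ^ 2 := by
          have a1 : 0 < -y := by linarith
          have a3 : 0 < 2 * (ν : ℝ) - 1 := by linarith
          positivity
        nlinarith [sq_nonneg (2 * (B12 ν).eval y - (2 * ν + 1) * (G ν).eval y)]
  by_contra! h'
  nlinarith

/-- Zeros and signs of `turning` on the real line, and of `E`. -/
theorem exists_turning_points (ν : ℕ) (hν : 1 ≤ ν) : ∃ yR yL : ℝ, 0 < yR ∧ yR < 4 ∧ 4 < yL ∧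
    (∀ y < yR, 0 < (turning ν).eval y) ∧ (turning ν).eval yR = 0 ∧
    (∀ y, yR < y → y < yL → (turning ν).eval y < 0) ∧ (turning ν).eval yL = 0 ∧
    (∀ y, yL < y → 0 < (turning ν).eval y) ∧
    (derivative (turning ν)).eval yR < 0 ∧ 0 < (derivative (turning ν)).eval yL ∧
    (E ν).eval (-√yR) = 0 ∧ (E ν).eval √yL = 0 ∧
    (∀ x, 0 < x → x ^ 2 < yL → x ≠ 2 → (E ν).eval x ≠ 0) := by
  have hν' : (1 : ℝ) ≤ ν := by exact_mod_cast hν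
  obtain ⟨x, hx0, hx2, hx, hxl, hxr⟩ := exists_zero_E_left ν hν
  obtain ⟨t, ht2, ht4, ht, htl, htr⟩ := exists_zero_E_right ν hν
  have hqx : (turning ν).eval (x ^ 2) = 0 := by
    have := eval_turning_sq ν x
    rw [hx, mul_zero, neg_zero] at this
    exact (mul_eq_zero.1 this).resolve_left (by nlinarith)
  have hqt : (turning ν).eval (t ^ 2) = 0 := by
    have := eval_turning_sq ν t
    rw [ht, zero_mul, neg_zero] at this
    exact (mul_eq_zero.1 this).resolve_left (by nlinarith)
  have hderiv : ∀ s, (E ν).eval s = 0 → -2 < s → s < 4 → s ≠ 2 →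
      0 < (derivative (E ν)).eval s := by
    intro s hs h1 h2 h3
    have := eval_E_ode ν s
    rw [hs, mul_zero, zero_sub] at this
    have h4 : (s + 2) * (derivative (E ν)).eval s = (2 * ν - 1) * (4 - s) *
        (B12 ν).eval (s ^ 2) := by
      apply mul_left_cancel₀ (sub_ne_zero.2 h3)
      linear_combination this
    have a1 := eval_B12_pos ν (sq_nonneg s)
    have a2 : 0 < 2 * (ν : ℝ) - 1 := by linarith
    have a3 : 0 < 4 - s := by linarith
    have a4 : 0 < (s + 2) * (derivative (E ν)).eval s := by rw [h4]; positivity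
    exact pos_of_mul_pos_right a4 (by linarith)
  refine ⟨x ^ 2, t ^ 2, by positivity, by nlinarith, by nlinarith, fun y hy => ?_, hqx,
    fun y h1 h2 => ?_, hqt, fun y h1 => ?_, ?_, ?_, ?_, ?_, ?_⟩
  · rcases le_or_gt y 0 with h | h
    · exact eval_turning_pos_of_nonpos ν h hν
    · have hs := eval_turning_sq ν (√y)
      have hsq := Real.sq_sqrt h.le
      have hpos := Real.sqrt_pos.2 h
      have hlt : √y < x := by rw [Real.sqrt_lt h.le hx0.le]; exact hy
      have e1 := hxr (√y) (by linarith) (by linarith)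
      have e2 := hxr (-√y) (by linarith) (by linarith)
      rw [hsq] at hs
      have hy4 : y < 4 := by nlinarith
      by_contra! h'
      nlinarith [mul_pos e1 e2, mul_nonneg_of_nonpos_of_nonpos (sub_nonpos.2 hy4.le) h']
  · have h0 : 0 < y := lt_trans (by positivity) h1
    have hs := eval_turning_sq ν (√y)
    have hsq := Real.sq_sqrt h0.le
    have hpos := Real.sqrt_pos.2 h0
    have hgt : x < √y := by rw [Real.lt_sqrt hx0.le]; exact h1
    have hlt : √y < t := by rw [Real.sqrt_lt h0.le (by linarith)]; exact h2
    rw [hsq] at hs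
    rcases lt_trichotomy (√y) 2 with h | h | h
    · have e1 := hxr (√y) (by linarith) (by linarith)
      have e2 := hxl (-√y) (by linarith) (by linarith)
      have : y < 4 := by nlinarith
      by_contra! h'
      nlinarith [mul_neg_of_pos_of_neg e1 e2]
    -- At y = 4 the factored identity reads 0 = 0; its derivative at x = 2 gives 4·T(4) =
    -- -E'(2)E(-2), with both factors negative.
    · have hd := eval_derivative_turning_sq ν 2
      have e1 := eval_derivative_E_two_neg ν hν
      have e2 := eval_E_neg_two ν hν
      rw [eval_E_two] at hd
      have : y = 2 ^ 2 := by rw [← hsq, h]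
      rw [this]
      nlinarith [mul_pos_of_neg_of_neg e1 e2]
    · have e1 := htl (√y) (by linarith) (by linarith)
      have e2 := eval_E_neg ν hν (show -√y < -2 by linarith)
      have : 4 < y := by nlinarith
      by_contra! h'
      nlinarith [mul_pos_of_neg_of_neg e1 e2]
  · have h0 : 0 < y := lt_trans (by positivity) h1
    have hs := eval_turning_sq ν (√y)
    have hsq := Real.sq_sqrt h0.le
    have hgt : t < √y := by rw [Real.lt_sqrt (by linarith)]; exact h1
    rw [hsq] at hs
    have e1 := htr (√y) hgt
    have e2 := eval_E_neg ν hν (show -√y < -2 by linarith)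
    have : 4 < y := by nlinarith
    by_contra! h'
    nlinarith [mul_neg_of_pos_of_neg e1 e2]
  · have hd := eval_derivative_turning_sq ν x
    rw [hx, hqx, mul_zero, mul_zero, zero_add, zero_sub, neg_neg] at hd
    have e1 := hxr x (by linarith) (by linarith)
    have e2 := hderiv (-x) hx (by linarith) (by linarith) (by linarith)
    have e3 : x ^ 2 - 4 < 0 := by nlinarith
    have e4 := mul_pos e1 e2
    rw [← hd] at e4
    by_contra! h'
    have : 0 ≤ 2 * x * (derivative (turning ν)).eval (x ^ 2) := by positivity
    nlinarith
  · have hd := eval_derivative_turning_sq ν t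
    rw [ht, hqt, mul_zero, zero_add, zero_mul, sub_zero] at hd
    have e1 := eval_E_neg ν hν (show -t < -2 by linarith)
    have e2 := hderiv t ht (by linarith) ht4 ht2.ne'
    have e3 : 0 < t ^ 2 - 4 := by nlinarith
    have e4 := mul_neg_of_pos_of_neg e2 e1
    by_contra! h'
    have : 2 * t * (derivative (turning ν)).eval (t ^ 2) ≤ 0 :=
      mul_nonpos_of_nonneg_of_nonpos (by linarith) h'
    nlinarith
  · rwa [Real.sqrt_sq hx0.le]
  · rwa [Real.sqrt_sq (by linarith)]
  · intro s hs hst hs2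
    rcases lt_or_gt_of_ne hs2 with h | h
    · exact (hxr s (by linarith) h).ne'
    · exact (htl s h (lt_of_pow_lt_pow_left₀ 2 (by linarith) hst)).ne

/-! ### Monotonicity and extrema of `xiSq`. -/

/-- Needed because for ν > 1 the derivative of ξ² also vanishes at the zeros of Λ, where ξ² stays
strictly monotone. -/
theorem strictMonoOn_of_deriv_nonneg_of_finite {D : Set ℝ} (hD : Convex ℝ D) {f : ℝ → ℝ}
    (hf : ContinuousOn f D) (hd : DifferentiableOn ℝ f (interior D))
    (h0 : ∀ x ∈ interior D, 0 ≤ deriv f x) (hfin : {x ∈ interior D | deriv f x = 0}.Finite) :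
    StrictMonoOn f D := by
  have hm := monotoneOn_of_deriv_nonneg hD hf hd h0
  intro x hx y hy hxy
  refine (hm hx hy hxy.le).lt_of_ne fun heq => ?_
  have hsub : Icc x y ⊆ D := hD.ordConnected.out hx hy
  have hsub' : Ioo x y ⊆ interior D := by
    rw [← interior_Icc]
    exact interior_mono hsub
  have hconst : ∀ z ∈ Ioo x y, f z = f x := fun z hz =>
    le_antisymm ((hm (hsub ⟨hz.1.le, hz.2.le⟩) hy hz.2.le).trans heq.ge)
      (hm hx (hsub ⟨hz.1.le, hz.2.le⟩) hz.1.le)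
  refine (Ioo_infinite hxy) (hfin.subset fun z hz => ⟨hsub' hz, ?_⟩)
  have : f =ᶠ[𝓝 z] fun _ => f x := by
    filter_upwards [isOpen_Ioo.mem_nhds hz] with t ht using hconst t ht
  rw [this.deriv_eq, deriv_const]

theorem not_isLocalExtr_of_strictMonoOn {f : ℝ → ℝ} {l u y : ℝ} (h : StrictMonoOn f (Ioo l u))
    (hy : y ∈ Ioo l u) : ¬ IsLocalExtr f y := by
  have hmem : Ioo l u ∈ 𝓝 y := isOpen_Ioo.mem_nhds hy
  rintro (hmin | hmax)
  · obtain ⟨z, ⟨hz1, hz2⟩, hz3⟩ := (((hmin.and hmem).filter_mono nhdsWithin_le_nhds).and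
      (self_mem_nhdsWithin (s := Iio y))).exists
    exact (h hz2 hy hz3).not_ge hz1
  · obtain ⟨z, ⟨hz1, hz2⟩, hz3⟩ := (((hmax.and hmem).filter_mono nhdsWithin_le_nhds).and
      (self_mem_nhdsWithin (s := Ioi y))).exists
    exact (h hy hz2 hz3).not_ge hz1

/-- The factor of `deriv (xiSq ν)` other than `turning`. -/
def weight (ν : ℕ) (y : ℝ) : ℝ :=
  (lam ν).eval y ^ (2 * ν - 2) / ((2 * (ν : ℝ) + 1) ^ 2 * (B12 ν).eval y ^ (2 * ν + 2))

theorem hasDerivAt_xiSq {ν : ℕ} (hν : 1 ≤ ν) {y : ℝ} (hy : (B12 ν).eval y ≠ 0) :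
    HasDerivAt (xiSq ν) (weight ν y * (turning ν).eval y) y := by
  obtain ⟨m, rfl⟩ : ∃ m, ν = m + 1 := ⟨ν - 1, by omega⟩
  have e1 : 2 * (m + 1) - 1 = 2 * m + 1 := by omega
  have e2 : 2 * (m + 1) - 2 = 2 * m := by omega
  have hj : (2 * ((m + 1 : ℕ) : ℝ) + 1) ≠ 0 := by positivity
  have h1 := (hasDerivAt_id y).mul (((lam (m + 1)).hasDerivAt y).pow (2 * m + 1))
  have h2 := (((B12 (m + 1)).hasDerivAt y).pow (2 * (m + 1) + 1)).const_mul
    ((2 * ((m + 1 : ℕ) : ℝ) + 1) ^ 2)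
  have h3 := h1.div h2 (mul_ne_zero (pow_ne_zero _ hj) (pow_ne_zero _ hy))
  have h4 : xiSq (m + 1) = fun y => y * (lam (m + 1)).eval y ^ (2 * m + 1) /
      ((2 * ((m + 1 : ℕ) : ℝ) + 1) ^ 2 * (B12 (m + 1)).eval y ^ (2 * (m + 1) + 1)) := by
    funext y
    rw [xiSq, e1]
  rw [h4]
  refine h3.congr_deriv ?_
  simp only [weight, turning, e2, eval_add, eval_sub, eval_mul, eval_C, eval_X, id_eq,
    Pi.pow_apply, Pi.mul_apply, Nat.add_sub_cancel]
  field_simp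
  push_cast
  ring

theorem weight_nonneg {ν : ℕ} (hν : 1 ≤ ν) (y : ℝ) : 0 ≤ weight ν y := by
  refine div_nonneg (Even.pow_nonneg ⟨ν - 1, by omega⟩ _)
    (mul_nonneg (sq_nonneg _) (Even.pow_nonneg ⟨ν + 1, by omega⟩ _))

theorem weight_pos {ν : ℕ} (hν : 1 ≤ ν) {y : ℝ} (hB : (B12 ν).eval y ≠ 0)
    (hl : (lam ν).eval y ≠ 0) : 0 < weight ν y := by
  refine (weight_nonneg hν y).lt_of_ne' (div_ne_zero (pow_ne_zero _ hl)
    (mul_ne_zero (pow_ne_zero _ (by positivity)) (pow_ne_zero _ hB)))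

theorem continuousAt_xiSq {ν : ℕ} (hν : 1 ≤ ν) {y : ℝ} (hy : (B12 ν).eval y ≠ 0) :
    ContinuousAt (xiSq ν) y := (hasDerivAt_xiSq hν hy).continuousAt

theorem finite_zeros_lam (ν : ℕ) : {y : ℝ | (lam ν).eval y = 0}.Finite :=
  finite_setOfPred_isRoot (lam_ne_zero ν)

theorem strictMonoOn_xiSq {ν : ℕ} (hν : 1 ≤ ν) {D : Set ℝ} (hD : Convex ℝ D)
    (hB : ∀ y ∈ D, (B12 ν).eval y ≠ 0) (hq : ∀ y ∈ interior D, 0 < (turning ν).eval y) :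
    StrictMonoOn (xiSq ν) D := by
  have hd : ∀ y ∈ interior D, deriv (xiSq ν) y = weight ν y * (turning ν).eval y := fun y hy =>
    (hasDerivAt_xiSq hν (hB y (interior_subset hy))).deriv
  refine strictMonoOn_of_deriv_nonneg_of_finite hD
    (fun y hy => (continuousAt_xiSq hν (hB y hy)).continuousWithinAt)
    (fun y hy => (hasDerivAt_xiSq hν (hB y (interior_subset hy))).differentiableAt
      |>.differentiableWithinAt)
    (fun y hy => ?_) ((finite_zeros_lam ν).subset fun y hy => ?_)
  · rw [hd y hy]
    exact mul_nonneg (weight_nonneg hν y) (hq y hy).le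
  · by_contra hl
    have h := hy.2
    rw [hd y hy.1] at h
    exact (mul_pos (weight_pos hν (hB y (interior_subset hy.1)) hl) (hq y hy.1)).ne' h

theorem strictAntiOn_xiSq {ν : ℕ} (hν : 1 ≤ ν) {D : Set ℝ} (hD : Convex ℝ D)
    (hB : ∀ y ∈ D, (B12 ν).eval y ≠ 0) (hq : ∀ y ∈ interior D, (turning ν).eval y < 0) :
    StrictAntiOn (xiSq ν) D := by
  have hd : ∀ y ∈ interior D, deriv (fun y => -xiSq ν y) y =
      -(weight ν y * (turning ν).eval y) := fun y hy =>
    (hasDerivAt_xiSq hν (hB y (interior_subset hy))).neg.deriv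
  suffices h : StrictMonoOn (fun y => -xiSq ν y) D from
    fun x hx y hy hxy => neg_lt_neg_iff.1 (h hx hy hxy)
  refine strictMonoOn_of_deriv_nonneg_of_finite hD
    (fun y hy => (continuousAt_xiSq hν (hB y hy)).neg.continuousWithinAt)
    (fun y hy => (hasDerivAt_xiSq hν (hB y (interior_subset hy))).neg.differentiableAt
      |>.differentiableWithinAt)
    (fun y hy => ?_) ((finite_zeros_lam ν).subset fun y hy => ?_)
  · rw [hd y hy]
    exact neg_nonneg.2 (mul_nonpos_of_nonneg_of_nonpos (weight_nonneg hν y) (hq y hy).le)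
  · by_contra hl
    have h := hy.2
    rw [hd y hy.1] at h
    exact (mul_neg_of_pos_of_neg (weight_pos hν (hB y (interior_subset hy.1)) hl)
      (hq y hy.1)).ne (neg_eq_zero.1 h)

theorem isOpen_regular (ν : ℕ) : IsOpen {y : ℝ | (B12 ν).eval y ≠ 0} :=
  isOpen_ne_fun (B12 ν).continuous continuous_const

theorem not_isLocalExtr_xiSq {ν : ℕ} (hν : 1 ≤ ν) {y : ℝ} (hB : (B12 ν).eval y ≠ 0)
    (hq : (turning ν).eval y ≠ 0) : ¬ IsLocalExtr (xiSq ν) y := by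
  have h1 : ∀ᶠ t in 𝓝 y, (B12 ν).eval t ≠ 0 := (isOpen_regular ν).mem_nhds hB
  rcases lt_or_gt_of_ne hq with hq | hq
  · have h2 : ∀ᶠ t in 𝓝 y, (turning ν).eval t < 0 :=
      (turning ν).continuous.continuousAt.eventually_lt_const hq
    obtain ⟨l, u, hy, hlu⟩ := mem_nhds_iff_exists_Ioo_subset.1 (h1.and h2)
    have h := strictAntiOn_xiSq hν (convex_Ioo l u) (fun t ht => (hlu ht).1)
      (fun t ht => (hlu (interior_subset ht)).2)
    intro he
    have h' : StrictMonoOn (fun t => -xiSq ν t) (Ioo l u) :=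
      fun a ha b hb hab => neg_lt_neg (h ha hb hab)
    exact not_isLocalExtr_of_strictMonoOn h' hy he.neg
  · have h2 : ∀ᶠ t in 𝓝 y, 0 < (turning ν).eval t :=
      (turning ν).continuous.continuousAt.eventually_const_lt hq
    obtain ⟨l, u, hy, hlu⟩ := mem_nhds_iff_exists_Ioo_subset.1 (h1.and h2)
    exact not_isLocalExtr_of_strictMonoOn (strictMonoOn_xiSq hν (convex_Ioo l u)
      (fun t ht => (hlu ht).1) (fun t ht => (hlu (interior_subset ht)).2)) hy

theorem deriv_deriv_xiSq {ν : ℕ} (hν : 1 ≤ ν) {y : ℝ} (hB : (B12 ν).eval y ≠ 0)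
    (hq : (turning ν).eval y = 0) :
    deriv (deriv (xiSq ν)) y = weight ν y * (derivative (turning ν)).eval y := by
  have h1 : deriv (xiSq ν) =ᶠ[𝓝 y] fun t => weight ν t * (turning ν).eval t := by
    filter_upwards [(isOpen_regular ν).mem_nhds hB] with t ht using (hasDerivAt_xiSq hν ht).deriv
  have hw : DifferentiableAt ℝ (weight ν) y := by
    refine DifferentiableAt.div ((lam ν).differentiable.differentiableAt.pow _)
      (((B12 ν).differentiable.differentiableAt.pow _).const_mul _) ?_
    exact mul_ne_zero (pow_ne_zero _ (by positivity)) (pow_ne_zero _ hB)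
  have h2 : HasDerivAt (fun t => weight ν t * (turning ν).eval t) _ y :=
    hw.hasDerivAt.mul ((turning ν).hasDerivAt y)
  rw [h1.deriv_eq, h2.deriv, hq]
  ring

/-! ### Orders of zeros and poles, and behaviour at infinity. -/

theorem meromorphicOrderAt_eq_of_eventuallyEq {f g : ℝ → ℝ} {x : ℝ} {n : ℤ}
    (hg : AnalyticAt ℝ g x) (hx : g x ≠ 0) (h : ∀ᶠ z in 𝓝[≠] x, f z = (z - x) ^ n * g z) :
    meromorphicOrderAt f x = (n : WithTop ℤ) := by
  have hm : MeromorphicAt (fun z => (z - x) ^ n * g z) x := by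
    have : MeromorphicAt (fun z => z - x) x := by fun_prop
    exact (this.zpow n).mul hg.meromorphicAt
  have hf : MeromorphicAt f x := hm.congr (h.mono fun z hz => hz.symm)
  exact (meromorphicOrderAt_eq_int_iff hf).2 ⟨g, hg, hx, h⟩

theorem analyticAt_eval (p : ℝ[X]) (x : ℝ) : AnalyticAt ℝ (fun y => p.eval y) x :=
  AnalyticOnNhd.eval_polynomial p x (mem_univ x)

theorem exists_factor {p : ℝ[X]} {c : ℝ} (h : p.eval c = 0) :
    ∃ R : ℝ[X], p = (X - C c) * R ∧ R.eval c = (derivative p).eval c := by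
  obtain ⟨R, hR⟩ := dvd_iff_isRoot.2 (show p.IsRoot c from h)
  refine ⟨R, hR, ?_⟩
  rw [hR, derivative_mul]
  simp

/-- Each term of `turning` contains Λ or Λ', so a double zero of Λ would be a zero of `turning`. -/
theorem derivative_lam_ne_zero {ν : ℕ} {c : ℝ} (hl : (lam ν).eval c = 0)
    (hq : (turning ν).eval c ≠ 0) : (derivative (lam ν)).eval c ≠ 0 := by
  intro h
  apply hq
  simp [turning, hl, h]

theorem meromorphicOrderAt_xiSq_zero {ν : ℕ} (hν : 1 ≤ ν) {c : ℝ} (hc : c ≠ 0)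
    (hB : (B12 ν).eval c ≠ 0) (hl : (lam ν).eval c = 0) (hq : (turning ν).eval c ≠ 0) :
    meromorphicOrderAt (xiSq ν) c = ((2 * (ν : ℤ) - 1 : ℤ) : WithTop ℤ) := by
  obtain ⟨R, hR, hRc⟩ := exists_factor hl
  have hR0 : R.eval c ≠ 0 := hRc ▸ derivative_lam_ne_zero hl hq
  have hden : (2 * (ν : ℝ) + 1) ^ 2 * (B12 ν).eval c ^ (2 * ν + 1) ≠ 0 :=
    mul_ne_zero (pow_ne_zero _ (by positivity)) (pow_ne_zero _ hB)
  refine meromorphicOrderAt_eq_of_eventuallyEq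
    (g := fun y => y * R.eval y ^ (2 * ν - 1) /
      ((2 * (ν : ℝ) + 1) ^ 2 * (B12 ν).eval y ^ (2 * ν + 1))) ?_ ?_ ?_
  · exact (analyticAt_id.mul ((analyticAt_eval R c).pow _)).div
      (analyticAt_const.mul ((analyticAt_eval _ c).pow _)) hden
  · exact div_ne_zero (mul_ne_zero hc (pow_ne_zero _ hR0)) hden
  · refine Eventually.of_forall fun z => ?_
    rw [show (2 * (ν : ℤ) - 1 : ℤ) = ((2 * ν - 1 : ℕ) : ℤ) by omega, zpow_natCast, xiSq, hR]
    simp only [eval_mul, eval_sub, eval_X, eval_C]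
    rw [mul_pow]
    ring

/-- Behaviour of `xiSq` at a zero of `B12`. -/
theorem exists_local_form_xiSq {ν : ℕ} (hν : 1 ≤ ν) {a : ℝ} (ha : (B12 ν).eval a = 0) :
    ∃ g : ℝ → ℝ, AnalyticAt ℝ g a ∧ g a < 0 ∧
      ∀ y, xiSq ν y = g y * ((y - a) ^ (2 * ν + 1))⁻¹ := by
  obtain ⟨R, hR, hRa⟩ := exists_factor ha
  have hR0 : R.eval a ≠ 0 := hRa ▸ derivative_B12_ne_zero ha
  have hneg := neg_of_eval_B12 ha
  have hden : (2 * (ν : ℝ) + 1) ^ 2 * R.eval a ^ (2 * ν + 1) ≠ 0 :=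
    mul_ne_zero (pow_ne_zero _ (by positivity)) (pow_ne_zero _ hR0)
  refine ⟨fun y => y * (lam ν).eval y ^ (2 * ν - 1) /
      ((2 * (ν : ℝ) + 1) ^ 2 * R.eval y ^ (2 * ν + 1)), ?_, ?_, ?_⟩
  · exact (analyticAt_id.mul ((analyticAt_eval _ a).pow _)).div
      (analyticAt_const.mul ((analyticAt_eval _ a).pow _)) hden
  · have h1 := eval_B12_system ν a
    have hl : (lam ν).eval a = a * (a - 4) / (2 * ν + 1) * R.eval a := by
      have hj : (2 * (ν : ℝ) + 1) ≠ 0 := by positivity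
      rw [lam_eq, eval_sub, ha, hRa]
      rw [ha] at h1
      field_simp
      linarith
    have hpos : 0 < a * (a - 4) / (2 * (ν : ℝ) + 1) :=
      div_pos (mul_pos_of_neg_of_neg hneg (by linarith)) (by positivity)
    -- Since Λ(a) is a positive multiple of R(a) = B'(a), the odd powers cancel down to R(a)² and
    -- only the sign of a survives.
    have : a * (lam ν).eval a ^ (2 * ν - 1) / ((2 * (ν : ℝ) + 1) ^ 2 * R.eval a ^ (2 * ν + 1)) =
        a * ((a * (a - 4) / (2 * ν + 1)) ^ (2 * ν - 1) /
          ((2 * (ν : ℝ) + 1) ^ 2 * R.eval a ^ 2)) := by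
      rw [hl, mul_pow, show 2 * ν + 1 = (2 * ν - 1) + 2 by omega, pow_add]
      field_simp
    simp only [this]
    exact mul_neg_of_neg_of_pos hneg (by positivity)
  · intro y
    rw [xiSq, hR]
    simp only [eval_mul, eval_sub, eval_X, eval_C]
    rw [mul_pow]
    simp only [div_eq_mul_inv, mul_inv]
    ring

theorem xiSq_pole {ν : ℕ} (hν : 1 ≤ ν) {a : ℝ} (ha : (B12 ν).eval a = 0) :
    Tendsto (xiSq ν) (𝓝[<] a) atTop ∧ Tendsto (xiSq ν) (𝓝[>] a) atBot ∧
      meromorphicOrderAt (xiSq ν) a = ((-(2 * (ν : ℤ) + 1) : ℤ) : WithTop ℤ) := by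
  obtain ⟨g, hg, hga, hxi⟩ := exists_local_form_xiSq hν ha
  have hc := hg.continuousAt.tendsto
  have h0 : Tendsto (fun y : ℝ => (y - a) ^ (2 * ν + 1)) (𝓝 a) (𝓝 0) := by
    have : Continuous fun y : ℝ => (y - a) ^ (2 * ν + 1) := by fun_prop
    simpa using this.tendsto a
  have hodd : Odd (2 * ν + 1) := ⟨ν, rfl⟩
  rw [funext hxi]
  refine ⟨?_, ?_, ?_⟩
  · refine (hc.mono_left nhdsWithin_le_nhds).neg_mul_atBot hga (tendsto_inv_nhdsLT_zero.comp ?_)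
    refine tendsto_nhdsWithin_iff.2 ⟨h0.mono_left nhdsWithin_le_nhds, ?_⟩
    filter_upwards [self_mem_nhdsWithin] with y hy
    have hy' : y - a < 0 := sub_neg.2 hy
    exact hodd.pow_neg hy'
  · refine (hc.mono_left nhdsWithin_le_nhds).neg_mul_atTop hga (tendsto_inv_nhdsGT_zero.comp ?_)
    refine tendsto_nhdsWithin_iff.2 ⟨h0.mono_left nhdsWithin_le_nhds, ?_⟩
    filter_upwards [self_mem_nhdsWithin] with y hy
    have hy' : 0 < y - a := sub_pos.2 hy
    exact pow_pos hy' _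
  · refine meromorphicOrderAt_eq_of_eventuallyEq hg hga.ne (Eventually.of_forall fun z => ?_)
    rw [zpow_neg, mul_comm, show (2 * (ν : ℤ) + 1) = ((2 * ν + 1 : ℕ) : ℤ) by push_cast; rfl,
      zpow_natCast]

theorem eval_inv_mul_pow {p : ℝ[X]} {n : ℕ} (hp : p.natDegree ≤ n) {t : ℝ} (ht : t ≠ 0) :
    p.eval t⁻¹ = (p.reflect n).eval t / t ^ n := by
  let := invertibleOfNonzero (inv_ne_zero ht)
  have := eval₂_reflect_mul_pow (RingHom.id ℝ) t⁻¹ n p hp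
  rw [invOf_eq_inv, inv_inv, inv_pow, ← div_eq_mul_inv] at this
  exact this.symm

/-- Behaviour of `xiSq` at infinity. -/
theorem exists_local_form_xiSq_inv {ν : ℕ} (hν : 1 ≤ ν) :
    ∃ g : ℝ → ℝ, AnalyticAt ℝ g 0 ∧ g 0 < 0 ∧
      ∀ t ≠ 0, xiSq ν t⁻¹ = t ^ (2 * ν - 1) * g t := by
  have hν' : (1 : ℝ) ≤ ν := by exact_mod_cast hν
  have hl0 : ((lam ν).reflect ν).eval 0 = 1 - 2 * ν := by
    rw [← coeff_zero_eq_eval_zero, coeff_reflect, revAt_le (Nat.zero_le _), Nat.sub_zero,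
      coeff_lam_self]
  have hB0 : ((B12 ν).reflect ν).eval 0 = 1 := by
    rw [← coeff_zero_eq_eval_zero, coeff_reflect, revAt_le (Nat.zero_le _), Nat.sub_zero,
      coeff_B12_self]
  refine ⟨fun t => ((lam ν).reflect ν).eval t ^ (2 * ν - 1) /
    ((2 * (ν : ℝ) + 1) ^ 2 * ((B12 ν).reflect ν).eval t ^ (2 * ν + 1)), ?_, ?_, ?_⟩
  · refine ((analyticAt_eval _ 0).pow _).div (analyticAt_const.mul ((analyticAt_eval _ 0).pow _)) ?_
    rw [hB0]
    simp only [one_pow, mul_one]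
    positivity
  · simp only [hl0, hB0]
    exact div_neg_of_neg_of_pos (Odd.pow_neg ⟨ν - 1, by omega⟩ (by linarith)) (by positivity)
  · intro t ht
    obtain ⟨m, rfl⟩ : ∃ m, ν = m + 1 := ⟨ν - 1, by omega⟩
    rw [xiSq, eval_inv_mul_pow (natDegree_lam_le _) ht, eval_inv_mul_pow (natDegree_B12_le _) ht,
      show 2 * (m + 1) - 1 = 2 * m + 1 by omega]
    beta_reduce
    -- At a zero of the denominator both sides are 0 by the convention for division by zero, so the
    -- identity holds for every t ≠ 0.
    by_cases hB : ((B12 (m + 1)).reflect (m + 1)).eval t = 0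
    · rw [hB]
      simp
    · rw [div_pow, div_pow, ← pow_mul, ← pow_mul,
        show (m + 1) * (2 * (m + 1) + 1) = (m + 1) * (2 * m + 1) + (2 * m + 1) + 1 by ring]
      field_simp
      ring

theorem xiSq_infinity {ν : ℕ} (hν : 1 ≤ ν) :
    Tendsto (xiSq ν) atTop (𝓝[<] 0) ∧ Tendsto (xiSq ν) atBot (𝓝[>] 0) ∧
      meromorphicOrderAt (fun t => xiSq ν t⁻¹) 0 = ((2 * (ν : ℤ) - 1 : ℤ) : WithTop ℤ) := by
  obtain ⟨g, hg, hg0, hxi⟩ := exists_local_form_xiSq_inv hν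
  have hodd : Odd (2 * ν - 1) := ⟨ν - 1, by omega⟩
  have hneg : ∀ᶠ t in 𝓝 (0 : ℝ), g t < 0 := hg.continuousAt.eventually_lt_const hg0
  have h0 : Tendsto (fun t : ℝ => t ^ (2 * ν - 1) * g t) (𝓝 0) (𝓝 0) := by
    have h1 : ContinuousAt (fun t : ℝ => t ^ (2 * ν - 1) * g t) 0 :=
      (continuousAt_id.pow _).mul hg.continuousAt
    have h2 := h1.tendsto
    rwa [zero_pow (by omega), zero_mul] at h2
  refine ⟨?_, ?_, ?_⟩
  · have hlim : Tendsto (fun t => xiSq ν t⁻¹) (𝓝[>] 0) (𝓝[<] 0) := by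
      refine tendsto_nhdsWithin_iff.2 ⟨(h0.mono_left nhdsWithin_le_nhds).congr' ?_, ?_⟩
      · filter_upwards [self_mem_nhdsWithin] with t ht using (hxi t (ne_of_gt ht)).symm
      · filter_upwards [self_mem_nhdsWithin, hneg.filter_mono nhdsWithin_le_nhds] with t ht h
        rw [hxi t (ne_of_gt ht)]
        exact mul_neg_of_pos_of_neg (pow_pos ht _) h
    simpa [Function.comp_def] using hlim.comp tendsto_inv_atTop_nhdsGT_zero
  · have hlim : Tendsto (fun t => xiSq ν t⁻¹) (𝓝[<] 0) (𝓝[>] 0) := by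
      refine tendsto_nhdsWithin_iff.2 ⟨(h0.mono_left nhdsWithin_le_nhds).congr' ?_, ?_⟩
      · filter_upwards [self_mem_nhdsWithin] with t ht using (hxi t (ne_of_lt ht)).symm
      · filter_upwards [self_mem_nhdsWithin, hneg.filter_mono nhdsWithin_le_nhds] with t ht h
        rw [hxi t (ne_of_lt ht)]
        exact mul_pos_of_neg_of_neg (hodd.pow_neg ht) h
    simpa [Function.comp_def] using hlim.comp tendsto_inv_atBot_nhdsLT_zero
  · refine meromorphicOrderAt_eq_of_eventuallyEq hg hg0.ne ?_
    filter_upwards [self_mem_nhdsWithin] with t ht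
    rw [hxi t ht, sub_zero, show (2 * (ν : ℤ) - 1 : ℤ) = ((2 * ν - 1 : ℕ) : ℤ) by omega,
      zpow_natCast]

/-! ### Asymptotes and connected components. -/

theorem eventually_eval_ne_zero {p : ℝ[X]} (hp : p ≠ 0) (b : ℝ) :
    ∀ᶠ y in 𝓝[≠] b, p.eval y ≠ 0 := by
  have hfin : ({y : ℝ | p.eval y = 0} \ {b}).Finite := (finite_setOfPred_isRoot hp).sdiff
  have h : ({y : ℝ | p.eval y = 0} \ {b})ᶜ ∈ 𝓝 b := hfin.isClosed.isOpen_compl.mem_nhds (by simp)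
  filter_upwards [nhdsWithin_le_nhds h, self_mem_nhdsWithin] with y h1 h2 h3
  exact h1 ⟨h3, h2⟩

theorem isHorizontalAsymptote_iff {ν : ℕ} (hν : 1 ≤ ν) (b : ℝ) :
    IsHorizontalAsymptote (curve ν) b ↔ (B12 ν).eval b = 0 := by
  constructor
  · intro h
    by_contra hb
    have hc := (continuousAt_xiSq hν hb).abs.eventually_lt_const
      (show |xiSq ν b| < |xiSq ν b| + 1 by linarith)
    obtain ⟨ε, hε, hball⟩ := Metric.eventually_nhds_iff.1 hc
    obtain ⟨p, hp, h1, h2⟩ := h (|xiSq ν b| + 1) ε hε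
    have := hball (show dist p.2 b < ε by rwa [Real.dist_eq])
    rw [hp.2] at h1
    linarith
  · intro hb M ε hε
    have h1 := (xiSq_pole hν hb).1.eventually_gt_atTop (max M 0)
    have h2 : ∀ᶠ y in 𝓝[<] b, (B12 ν).eval y ≠ 0 := by
      have h3 := eventually_eval_ne_zero (B12_monic ν).ne_zero b
      exact h3.filter_mono (nhdsWithin_mono _ fun x hx => ne_of_lt hx)
    have h3 : ∀ᶠ y in 𝓝[<] b, |y - b| < ε := by
      have := Metric.ball_mem_nhds b hε
      filter_upwards [nhdsWithin_le_nhds this] with y hy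
      rwa [Metric.mem_ball, Real.dist_eq] at hy
    obtain ⟨y, hy1, hy2, hy3⟩ := (h1.and (h2.and h3)).exists
    exact ⟨(xiSq ν y, y), ⟨hy2, rfl⟩,
      ((le_max_left _ _).trans_lt hy1).trans_le (le_abs_self _), hy3⟩

/-- The part of the curve over an interval that is bounded by poles or by infinity is a connected
component. -/
theorem isComponent_curve {ν : ℕ} (hν : 1 ≤ ν) {I : Set ℝ} (hI : IsPreconnected I)
    (hne : I.Nonempty) (hB : ∀ y ∈ I, (B12 ν).eval y ≠ 0)
    (hmax : ∀ y ∈ I, ∀ t ∉ I, ∃ b ∈ uIcc y t, (B12 ν).eval b = 0) :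
    IsComponent (curve ν) {p ∈ curve ν | p.2 ∈ I} := by
  obtain ⟨y, hy⟩ := hne
  have himage : {p ∈ curve ν | p.2 ∈ I} = (fun t => (xiSq ν t, t)) '' I := by
    ext p
    constructor
    · rintro ⟨⟨-, h2⟩, h3⟩
      exact ⟨p.2, h3, Prod.ext h2.symm rfl⟩
    · rintro ⟨t, ht, rfl⟩
      exact ⟨⟨hB t ht, rfl⟩, ht⟩
  have hmem : (xiSq ν y, y) ∈ curve ν := ⟨hB y hy, rfl⟩
  refine ⟨(xiSq ν y, y), hmem, Subset.antisymm ?_ ?_⟩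
  · intro p hp
    have hpc := connectedComponentIn_subset _ _ hp
    refine ⟨hpc, ?_⟩
    by_contra hpI
    obtain ⟨b, hb, hb0⟩ := hmax y hy p.2 hpI
    -- The projection to the y₀-axis is order-connected, so it would contain the separating zero b,
    -- a height at which the curve has no point.
    have hpre : IsPreconnected (Prod.snd '' connectedComponentIn (curve ν) (xiSq ν y, y)) :=
      isPreconnected_connectedComponentIn.image _ continuous_snd.continuousOn
    obtain ⟨p', hp', rfl⟩ := hpre.ordConnected.uIcc_subset
      ⟨_, mem_connectedComponentIn hmem, rfl⟩ ⟨p, hp, rfl⟩ hb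
    exact (connectedComponentIn_subset _ _ hp').1 hb0
  · refine IsPreconnected.subset_connectedComponentIn ?_ ⟨hmem, hy⟩ fun p hp => hp.1
    rw [himage]
    exact hI.image _ fun t ht =>
      ((continuousAt_xiSq hν (hB t ht)).prodMk continuousAt_id).continuousWithinAt

/-! ### Zeros of d_∓ / r_±. -/

theorem sqrtF0_sq (ν : ℕ) (w y : ℝ) : sqrtF0 ν w y ^ 2 = ((w * z0 ν y : ℝ) : ℂ) := by
  have h := Complex.cpow_nat_inv_pow ((w * z0 ν y : ℝ) : ℂ) two_ne_zero
  rw [sqrtF0, one_div]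
  exact_mod_cast h

/-- Substituting w = f₀Λ/B = f₀(1 - G/B) makes f₀ a common factor; what remains is d̂_±. Squared
moduli then avoid tracking whether √f₀ is real or imaginary. -/
theorem d_eq (ν : ℕ) (w : ℝ) {y : ℝ} (hy : 0 < y) (hl : (lam ν).eval y ≠ 0) {τ : ℤ}
    (hτ : τ ^ 2 = 1) : d τ ν w y =
      sqrtF0 ν w y ^ 2 * (((E ν).eval (τ * √y) / (B12 ν).eval y : ℝ) : ℂ) := by
  have hB := (eval_B12_pos ν hy.le).ne'
  have hsq : ((τ : ℝ) * √y) ^ 2 = y := by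
    rw [mul_pow, Real.sq_sqrt hy.le]
    have : (τ : ℝ) ^ 2 = 1 := by exact_mod_cast hτ
    rw [this, one_mul]
  have key : (2 * (ν : ℝ) + 1) * w - (2 * ν - 1) * (w * z0 ν y) +
      τ * ((2 * ν - 1) * (√y * (w * z0 ν y))) =
      w * z0 ν y * ((E ν).eval (τ * √y) / (B12 ν).eval y) := by
    have hG : (G ν).eval y = (B12 ν).eval y - (lam ν).eval y := by
      rw [lam_eq, eval_sub]; ring
    rw [eval_E, hsq, hG, z0]
    field_simp
    ring
  have hd : d τ ν w y = (((2 * (ν : ℝ) + 1) * w - (2 * ν - 1) * (w * z0 ν y) +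
      τ * ((2 * ν - 1) * (√y * (w * z0 ν y))) : ℝ) : ℂ) := by
    have h := sqrtF0_sq ν w y
    rw [d, h0]
    push_cast at h ⊢
    linear_combination (τ : ℂ) * (2 * ν - 1) * (√y : ℂ) * h
  rw [hd, key, sqrtF0_sq]
  push_cast
  ring

/-- The squared modulus of `d_∓ / r_±`. -/
theorem norm_d_div_r_sq (ν : ℕ) {w y : ℝ} (hw : 0 < w) (hy : 0 < y) (hl : (lam ν).eval y ≠ 0)
    {τ : ℤ} (hτ : τ ^ 2 = 1) (σ : ℤ) :
    ‖d τ ν w y / r σ ν w y‖ ^ 2 = w * ((B12 ν).eval y / |(lam ν).eval y|) *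
      ((E ν).eval (τ * √y) / ((B12 ν).eval y * (√y + 2 * σ))) ^ 2 := by
  have hB := eval_B12_pos ν hy.le
  have hr : r σ ν w y = sqrtF0 ν w y * ((√y + 2 * σ : ℝ) : ℂ) := by
    rw [r, h0]
    push_cast
    ring
  have hs : sqrtF0 ν w y ≠ 0 := by
    intro h
    have h2 := sqrtF0_sq ν w y
    rw [h, zero_pow two_ne_zero] at h2
    have h3 : w * z0 ν y = 0 := by exact_mod_cast h2.symm
    exact mul_ne_zero hw.ne' (div_ne_zero hB.ne' hl) h3
  have hdr : d τ ν w y / r σ ν w y = sqrtF0 ν w y *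
      (((E ν).eval (τ * √y) / ((B12 ν).eval y * (√y + 2 * σ)) : ℝ) : ℂ) := by
    rw [d_eq ν w hy hl hτ, hr, sq, mul_assoc, mul_div_mul_left _ _ hs, mul_div_assoc,
      ← Complex.ofReal_div, div_div]
  rw [hdr, norm_mul, mul_pow, ← norm_pow, sqrtF0_sq, Complex.norm_real, Complex.norm_real,
    Real.norm_eq_abs, Real.norm_eq_abs, sq_abs, abs_mul, z0, abs_div, abs_of_pos hw,
    abs_of_pos hB]

theorem isZeroAt_of_eval_E {ν : ℕ} {w y : ℝ} (hw : 0 < w) (hy : 0 < y)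
    (hl : (lam ν).eval y ≠ 0) {τ : ℤ} (hτ : τ ^ 2 = 1) {σ : ℤ} (hσ : √y + 2 * σ ≠ 0)
    (hE : (E ν).eval (τ * √y) = 0) :
    IsZeroAt (fun y => d τ ν w y / r σ ν w y) y := by
  have hB := eval_B12_pos ν hy.le
  have hcont : ContinuousAt (fun y => w * ((B12 ν).eval y / |(lam ν).eval y|) *
      ((E ν).eval (τ * √y) / ((B12 ν).eval y * (√y + 2 * σ))) ^ 2) y := by
    have hs : Continuous fun y : ℝ => (τ : ℝ) * √y := by fun_prop
    have hE' : ContinuousAt (fun y : ℝ => (E ν).eval (τ * √y)) y :=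
      ((E ν).continuous.comp hs).continuousAt
    have hr : ContinuousAt (fun y : ℝ => √y + 2 * (σ : ℝ)) y := by fun_prop
    have hB' : ContinuousAt (fun y : ℝ => (B12 ν).eval y) y := (B12 ν).continuous.continuousAt
    have hl' : ContinuousAt (fun y : ℝ => |(lam ν).eval y|) y :=
      (lam ν).continuous.abs.continuousAt
    exact (continuousAt_const.mul (hB'.div hl' (abs_ne_zero.2 hl))).mul
      ((hE'.div (hB'.mul hr) (mul_ne_zero hB.ne' hσ)).pow 2)
  have ht := hcont.tendsto
  simp only [hE, zero_div, ne_eq, OfNat.ofNat_ne_zero, not_false_eq_true, zero_pow,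
    mul_zero] at ht
  have hl' : ∀ᶠ t in 𝓝 y, (lam ν).eval t ≠ 0 :=
    (lam ν).continuous.continuousAt.eventually_ne hl
  have hsq : Tendsto (fun t => ‖d τ ν w t / r σ ν w t‖ ^ 2) (𝓝 y) (𝓝 0) := by
    refine ht.congr' ?_
    filter_upwards [hl', eventually_gt_nhds hy] with t h1 h2
    exact (norm_d_div_r_sq ν hw h2 h1 hτ σ).symm
  have hn : Tendsto (fun t => ‖d τ ν w t / r σ ν w t‖) (𝓝 y) (𝓝 0) := by
    have := hsq.sqrt
    simpa only [Real.sqrt_sq (norm_nonneg _), Real.sqrt_zero] using this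
  exact (tendsto_zero_iff_norm_tendsto_zero.2 hn).mono_left nhdsWithin_le_nhds

/-- The hypothesis exempts √y = 2, where E and r₋ vanish together: cancelling x-2 leaves E'(2) ≠ 0,
so y = 4 is not a zero of d₊/r₋. -/
theorem not_isZeroAt_of_eval_E {ν : ℕ} (hν : 1 ≤ ν) {w y : ℝ} (hw : 0 < w) (hy : 0 < y)
    (hE : √y ≠ 2 → (E ν).eval √y ≠ 0) :
    ¬ IsZeroAt (fun y => d 1 ν w y / r (-1) ν w y) y := by
  intro h
  have hB := eval_B12_pos ν hy.le
  obtain ⟨H, hH, hH2⟩ := exists_factor (eval_E_two ν)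
  have hH0 : H.eval √y ≠ 0 := by
    by_cases h2 : √y = 2
    · rw [h2, hH2]
      exact (eval_derivative_E_two_neg ν hν).ne
    · intro h0
      apply hE h2
      rw [hH, eval_mul, h0, mul_zero]
  -- The factor |Λ| cancels the pole of f₀ at a zero of Λ, so such points need no separate case.
  have h1 : Tendsto (fun t => ‖d 1 ν w t / r (-1) ν w t‖ ^ 2 * |(lam ν).eval t|)
      (𝓝[≠] y) (𝓝 0) := by
    have hl : Tendsto (fun t => |(lam ν).eval t|) (𝓝[≠] y) (𝓝 |(lam ν).eval y|) :=
      ((lam ν).continuous.abs.tendsto y).mono_left nhdsWithin_le_nhds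
    simpa using (h.norm.pow 2).mul hl
  have h2 : Tendsto (fun t => w * (H.eval √t ^ 2 / (B12 ν).eval t)) (𝓝[≠] y)
      (𝓝 (w * (H.eval √y ^ 2 / (B12 ν).eval y))) := by
    have hs : ContinuousAt (fun t : ℝ => H.eval √t) y :=
      (H.continuous.comp Real.continuous_sqrt).continuousAt
    have hc : ContinuousAt (fun t => w * (H.eval √t ^ 2 / (B12 ν).eval t)) y :=
      continuousAt_const.mul ((hs.pow 2).div (B12 ν).continuous.continuousAt hB.ne')
    exact hc.tendsto.mono_left nhdsWithin_le_nhds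
  have h3 : (fun t => ‖d 1 ν w t / r (-1) ν w t‖ ^ 2 * |(lam ν).eval t|) =ᶠ[𝓝[≠] y]
      fun t => w * (H.eval √t ^ 2 / (B12 ν).eval t) := by
    have hX : ∀ᶠ t in 𝓝[≠] y, (X - C 4 : ℝ[X]).eval t ≠ 0 :=
      eventually_eval_ne_zero (X_sub_C_ne_zero 4) y
    filter_upwards [eventually_eval_ne_zero (lam_ne_zero ν) y,
      (eventually_gt_nhds hy).filter_mono nhdsWithin_le_nhds, hX] with t hl ht h4
    have hBt := eval_B12_pos ν ht.le
    have hne : √t - 2 ≠ 0 := by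
      intro h
      have := Real.sq_sqrt ht.le
      rw [sub_eq_zero.1 h] at this
      apply h4
      simp only [eval_sub, eval_X, eval_C]
      linarith
    have hEt : (E ν).eval √t = (√t - 2) * H.eval √t := by
      conv_lhs => rw [hH]
      simp
    have hla : |(lam ν).eval t| ≠ 0 := abs_ne_zero.2 hl
    rw [norm_d_div_r_sq ν hw ht hl (one_pow 2) (-1)]
    push_cast
    rw [one_mul, hEt, show √t + 2 * (-1) = √t - 2 by ring]
    field_simp
  have h4 := tendsto_nhds_unique (h1.congr' h3) h2
  have : 0 < w * (H.eval √y ^ 2 / (B12 ν).eval y) := by positivity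
  exact this.ne h4

/-! ### The scaled discriminant. -/

theorem isCoprime_turning_B12 (ν : ℕ) (hν : 1 ≤ ν) : IsCoprime (turning ν) (B12 ν) := by
  obtain ⟨a, -, hneg, hB⟩ := exists_zeros_B12 ν
  rw [hB]
  refine IsCoprime.prod_right fun i _ => IsCoprime.symm ?_
  rw [(irreducible_X_sub_C (a i)).coprime_iff_not_dvd, dvd_iff_isRoot]
  exact (eval_turning_pos_of_nonpos ν (hneg i).le hν).ne'

theorem DHat_eq (ν : ℕ) {ζ : ℂ} (h : aeval (ζ ^ 2) (B12 ν) ≠ 0) :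
    DHat ν ζ = (ζ ^ 2 - 4) * (aeval (ζ ^ 2) (-turning ν) / aeval (ζ ^ 2) (B12 ν) ^ 2) := by
  have hq := congrArg (aeval (ζ ^ 2)) (turning_eq ν)
  have hG : ζ * aeval ζ (B11 ν) = aeval (ζ ^ 2) (G ν) := by
    simp only [B11, G, map_mul, map_ofNat, aeval_X, aeval_comp, map_pow]
    ring
  simp only [map_mul, map_sub, map_pow, map_ofNat, aeval_X, aeval_C, Complex.coe_algebraMap] at hq
  push_cast at hq
  rw [DHat, dHat, dHat, hG, map_neg, ← mul_div_assoc (ζ ^ 2 - 4), eq_div_iff (pow_ne_zero 2 h)]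
  push_cast
  field_simp
  linear_combination hq

/-! ### The branches of the curve. -/

theorem xiSq_eq_zero_iff {ν : ℕ} (hν : 1 ≤ ν) {y : ℝ} (hy : y ≠ 0) (hB : (B12 ν).eval y ≠ 0) :
    xiSq ν y = 0 ↔ (lam ν).eval y = 0 := by
  have hden : (2 * (ν : ℝ) + 1) ^ 2 * (B12 ν).eval y ^ (2 * ν + 1) ≠ 0 :=
    mul_ne_zero (pow_ne_zero _ (by positivity)) (pow_ne_zero _ hB)
  rw [xiSq, div_eq_zero_iff, or_iff_left hden, mul_eq_zero, or_iff_right hy,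
    pow_eq_zero_iff (by omega)]

/-- At the singular point 4 the first equation of the system gives (2ν+1)G = 4νB, hence Λ =
-(2ν-1)B/(2ν+1) < 0. This places y₀* below 4. -/
theorem xiSq_four_neg {ν : ℕ} (hν : 1 ≤ ν) : xiSq ν 4 < 0 := by
  have hν' : (1 : ℝ) ≤ ν := by exact_mod_cast hν
  have hB := eval_B12_pos ν (show (0 : ℝ) ≤ 4 by norm_num)
  have h := eval_B12_system ν 4
  have hl : (lam ν).eval 4 < 0 := by
    rw [lam_eq, eval_sub]
    nlinarith
  refine div_neg_of_neg_of_pos (mul_neg_of_pos_of_neg (by norm_num) ?_) (by positivity)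
  exact Odd.pow_neg ⟨ν - 1, by omega⟩ hl

theorem exists_zero_of_tendsto_poles {f : ℝ → ℝ} {l u : ℝ} (hlu : l < u)
    (hf : ContinuousOn f (Ioo l u)) (hl : Tendsto f (𝓝[>] l) atBot)
    (hu : Tendsto f (𝓝[<] u) atTop) : ∃ c ∈ Ioo l u, f c = 0 := by
  obtain ⟨s, hs0, hs⟩ := ((hl.eventually_lt_atBot 0).and (Ioo_mem_nhdsGT hlu)).exists
  obtain ⟨t, ht0, ht⟩ := ((hu.eventually_gt_atTop 0).and (Ioo_mem_nhdsLT hlu)).exists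
  obtain ⟨c, hc, hc0⟩ := isPreconnected_Ioo.intermediate_value hs ht hf ⟨hs0.le, ht0.le⟩
  exact ⟨c, hc, hc0⟩

/-- The part of the curve between consecutive poles. -/
theorem xiSq_between_poles {ν : ℕ} (hν : 1 ≤ ν) {l u : ℝ} (hlu : l < u) (hl : (B12 ν).eval l = 0)
    (hu : (B12 ν).eval u = 0) (hB : ∀ y ∈ Ioo l u, (B12 ν).eval y ≠ 0) :
    IsComponent (curve ν) {p ∈ curve ν | l < p.2 ∧ p.2 < u} ∧
      StrictMonoOn (xiSq ν) (Ioo l u) ∧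
      ∃ c ∈ Ioo l u, (∀ y ∈ Ioo l u, (lam ν).eval y = 0 ↔ y = c) ∧
        (∀ y ∈ Ioo l u, xiSq ν y = 0 ↔ y = c) ∧
        meromorphicOrderAt (xiSq ν) c = ((2 * (ν : ℤ) - 1 : ℤ) : WithTop ℤ) := by
  have hu0 := neg_of_eval_B12 hu
  have hmono : StrictMonoOn (xiSq ν) (Ioo l u) := by
    refine strictMonoOn_xiSq hν (convex_Ioo l u) hB fun y hy => ?_
    exact eval_turning_pos_of_nonpos ν ((interior_subset hy).2.trans hu0).le hν
  refine ⟨?_, hmono, ?_⟩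
  · refine isComponent_curve hν (I := Ioo l u) isPreconnected_Ioo (nonempty_Ioo.2 hlu) hB ?_
    intro y hy t ht
    rcases le_or_gt t l with h | h
    · exact ⟨l, mem_uIcc.2 (Or.inr ⟨h, hy.1.le⟩), hl⟩
    · exact ⟨u, mem_uIcc.2 (Or.inl ⟨hy.2.le, not_lt.1 fun h' => ht ⟨h, h'⟩⟩), hu⟩
  · obtain ⟨c, hc, hc0⟩ := exists_zero_of_tendsto_poles hlu
      (fun y hy => (continuousAt_xiSq hν (hB y hy)).continuousWithinAt)
      (xiSq_pole hν hl).2.1 (xiSq_pole hν hu).1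
    have hxi : ∀ y ∈ Ioo l u, xiSq ν y = 0 ↔ y = c := fun y hy =>
      ⟨fun h => hmono.injOn hy hc (h.trans hc0.symm), fun h => h ▸ hc0⟩
    have hiff : ∀ y ∈ Ioo l u, xiSq ν y = 0 ↔ (lam ν).eval y = 0 := fun y hy =>
      xiSq_eq_zero_iff hν (hy.2.trans hu0).ne (hB y hy)
    refine ⟨c, hc, fun y hy => (hiff y hy).symm.trans (hxi y hy), hxi, ?_⟩
    have hcneg := hc.2.trans hu0
    exact meromorphicOrderAt_xiSq_zero hν hcneg.ne (hB c hc) ((hiff c hc).1 hc0)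
      (eval_turning_pos_of_nonpos ν hcneg.le hν).ne'

/-- The part of the curve above the highest pole. -/
theorem xiSq_above_poles {ν : ℕ} (hν : 1 ≤ ν) {a : ℝ} (ha : a < 0)
    (hB : ∀ y, a < y → (B12 ν).eval y ≠ 0) :
    ∃ yR yStar yL : ℝ,
      0 < yR ∧ yR < yStar ∧ yStar < 4 ∧ 4 < yL ∧
      StrictMonoOn (xiSq ν) (Ioc a yR) ∧
      xiSq ν 0 = 0 ∧
      0 < xiSq ν yR ∧ deriv (xiSq ν) yR = 0 ∧ deriv (deriv (xiSq ν)) yR < 0 ∧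
      (∀ w : ℝ, 0 < w → IsZeroAt (fun y => d (-1) ν w y / r 1 ν w y) yR) ∧
      StrictAntiOn (xiSq ν) (Icc yR yL) ∧
      (∀ y : ℝ, 0 < y → ((lam ν).eval y = 0 ↔ y = yStar)) ∧
      (∀ y : ℝ, 0 < y → (xiSq ν y = 0 ↔ y = yStar)) ∧
      meromorphicOrderAt (xiSq ν) yStar = ((2 * (ν : ℤ) - 1 : ℤ) : WithTop ℤ) ∧
      xiSq ν yL < 0 ∧ deriv (xiSq ν) yL = 0 ∧ 0 < deriv (deriv (xiSq ν)) yL ∧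
      (∀ w : ℝ, 0 < w →
        IsLeast {y : ℝ | 0 < y ∧ IsZeroAt (fun x => d 1 ν w x / r (-1) ν w x) y} yL) ∧
      StrictMonoOn (xiSq ν) (Ici yL) ∧
      Tendsto (xiSq ν) atTop (𝓝[<] 0) ∧
      {y : ℝ | (B12 ν).eval y ≠ 0 ∧ IsLocalExtr (xiSq ν) y} = {yR, yL} := by
  obtain ⟨yR, yL, hR0, hR4, hL4, hqR, hqR0, hqm, hqL0, hqL, hdR, hdL, hER, hEL, hEne⟩ :=
    exists_turning_points ν hν
  have hL0 : 0 < yL := by linarith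
  have hBpos : ∀ y : ℝ, 0 < y → (B12 ν).eval y ≠ 0 := fun y hy => (eval_B12_pos ν hy.le).ne'
  have hmono : StrictMonoOn (xiSq ν) (Ioc a yR) := by
    refine strictMonoOn_xiSq hν (convex_Ioc a yR) (fun y hy => hB y hy.1) fun y hy => ?_
    rw [interior_Ioc] at hy
    exact hqR y hy.2
  have hanti : StrictAntiOn (xiSq ν) (Icc yR yL) := by
    refine strictAntiOn_xiSq hν (convex_Icc yR yL) (fun y hy => hBpos y (hR0.trans_le hy.1))
      fun y hy => ?_
    rw [interior_Icc] at hy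
    exact hqm y hy.1 hy.2
  have hmonoL : StrictMonoOn (xiSq ν) (Ici yL) := by
    refine strictMonoOn_xiSq hν (convex_Ici yL) (fun y hy => hBpos y (hL0.trans_le hy))
      fun y hy => ?_
    rw [interior_Ici] at hy
    exact hqL y hy
  have hxi0 : xiSq ν 0 = 0 := by simp [xiSq]
  have hpos : ∀ y, 0 < y → y ≤ yR → 0 < xiSq ν y := fun y h1 h2 =>
    hxi0 ▸ hmono ⟨ha, hR0.le⟩ ⟨ha.trans h1, h2⟩ h1
  -- On [y_L,∞) the function increases and is negative far out, so it is negative throughout.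
  have hneg : ∀ y, yL ≤ y → xiSq ν y < 0 := by
    intro y hy
    obtain ⟨t, ht, hyt⟩ := (((tendsto_nhdsWithin_iff.1 (xiSq_infinity hν).1).2).and
      (eventually_gt_atTop y)).exists
    exact (hmonoL hy (hy.trans hyt.le) hyt).trans ht
  obtain ⟨yS, hS, hS0⟩ : ∃ yS ∈ Ioo yR 4, xiSq ν yS = 0 :=
    intermediate_value_Ioo' hR4.le
      (fun y hy => (continuousAt_xiSq hν (hBpos y (hR0.trans_le hy.1))).continuousWithinAt)
      ⟨xiSq_four_neg hν, hpos yR hR0 le_rfl⟩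
  have hSpos : 0 < yS := hR0.trans hS.1
  have hxi : ∀ y : ℝ, 0 < y → (xiSq ν y = 0 ↔ y = yS) := by
    refine fun y hy => ⟨fun h => ?_, fun h => h ▸ hS0⟩
    rcases le_or_gt y yR with h1 | h1
    · exact absurd h (hpos y hy h1).ne'
    rcases le_or_gt yL y with h2 | h2
    · exact absurd h (hneg y h2).ne
    · exact hanti.injOn ⟨h1.le, h2.le⟩ ⟨hS.1.le, (hS.2.trans hL4).le⟩ (h.trans hS0.symm)
  have hlam : ∀ y : ℝ, 0 < y → ((lam ν).eval y = 0 ↔ y = yS) := fun y hy =>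
    (xiSq_eq_zero_iff hν hy.ne' (hBpos y hy)).symm.trans (hxi y hy)
  have hlR : (lam ν).eval yR ≠ 0 := fun h => hS.1.ne ((hlam yR hR0).1 h)
  have hlL : (lam ν).eval yL ≠ 0 := fun h => (hS.2.trans hL4).ne' ((hlam yL hL0).1 h)
  have hderR : deriv (xiSq ν) yR = 0 := by
    rw [(hasDerivAt_xiSq hν (hBpos yR hR0)).deriv, hqR0, mul_zero]
  have hderL : deriv (xiSq ν) yL = 0 := by
    rw [(hasDerivAt_xiSq hν (hBpos yL hL0)).deriv, hqL0, mul_zero]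
  have hderR2 : deriv (deriv (xiSq ν)) yR < 0 := by
    rw [deriv_deriv_xiSq hν (hBpos yR hR0) hqR0]
    exact mul_neg_of_pos_of_neg (weight_pos hν (hBpos yR hR0) hlR) hdR
  have hderL2 : 0 < deriv (deriv (xiSq ν)) yL := by
    rw [deriv_deriv_xiSq hν (hBpos yL hL0) hqL0]
    exact mul_pos (weight_pos hν (hBpos yL hL0) hlL) hdL
  have hsqrtL : 2 < √yL := by
    rw [Real.lt_sqrt (by norm_num)]
    linarith
  refine ⟨yR, yS, yL, hR0, hS.1, hS.2, hL4, hmono, hxi0, hpos yR hR0 le_rfl, hderR, hderR2, ?_,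
    hanti, hlam, hxi, ?_, hneg yL le_rfl, hderL, hderL2, ?_, hmonoL, (xiSq_infinity hν).1, ?_⟩
  · intro w hw
    refine isZeroAt_of_eval_E hw hR0 hlR (by norm_num) ?_ (by simpa using hER)
    have := Real.sqrt_nonneg yR
    push_cast
    linarith
  · exact meromorphicOrderAt_xiSq_zero hν hSpos.ne' (hBpos yS hSpos) ((hlam yS hSpos).2 rfl)
      (hqm yS hS.1 (hS.2.trans hL4)).ne
  · intro w hw
    refine ⟨⟨hL0, isZeroAt_of_eval_E hw hL0 hlL (one_pow 2) ?_ (by simpa using hEL)⟩, ?_⟩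
    · push_cast
      linarith
    · rintro y ⟨hy, hz⟩
      by_contra! hlt
      refine not_isZeroAt_of_eval_E hν hw hy (fun h2 => ?_) hz
      exact hEne (√y) (Real.sqrt_pos.2 hy) (by rwa [Real.sq_sqrt hy.le]) h2
  · ext y
    simp only [mem_ofPred_eq, mem_insert_iff, mem_singleton_iff]
    constructor
    · rintro ⟨h1, h2⟩
      by_contra! hne
      refine not_isLocalExtr_xiSq hν h1 ?_ h2
      rcases lt_or_gt_of_ne hne.1 with h | h
      · exact (hqR y h).ne'
      rcases lt_or_gt_of_ne hne.2 with h' | h'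
      · exact (hqm y h h').ne
      · exact (hqL y h').ne'
    · rintro (rfl | rfl)
      · exact ⟨hBpos y hR0, Or.inr (isLocalMax_of_deriv_deriv_neg hderR2 hderR
          (continuousAt_xiSq hν (hBpos y hR0)))⟩
      · exact ⟨hBpos y hL0, Or.inl (isLocalMin_of_deriv_deriv_pos hderL2 hderL
          (continuousAt_xiSq hν (hBpos y hL0)))⟩

end SpectralCurve

end

open SpectralCurve in
theorem theorem5p3 (ν : ℕ) (hν : 1 ≤ ν) :
    (∃ a : Fin ν → ℝ,
      -- (a) the `ν` zeros of `B̂₁₂`, all negative, are the horizontal asymptotes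
      StrictMono a ∧ (∀ i, a i < 0) ∧
      (∀ z : ℂ, aeval z (B12 ν) = 0 ↔ ∃ i, z = (a i : ℂ)) ∧
      (∀ b : ℝ, IsHorizontalAsymptote (curve ν) b ↔ ∃ i, b = a i) ∧
      (∀ i, Tendsto (xiSq ν) (𝓝[<] (a i)) atTop ∧ Tendsto (xiSq ν) (𝓝[>] (a i)) atBot ∧
        meromorphicOrderAt (xiSq ν) (a i) = ((-(2 * (ν : ℤ) + 1) : ℤ) : WithTop ℤ)) ∧
      -- between consecutive asymptotes
      (∀ i k : Fin ν, (k : ℕ) = i + 1 →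
        IsComponent (curve ν) {p ∈ curve ν | a i < p.2 ∧ p.2 < a k} ∧
        StrictMonoOn (xiSq ν) (Ioo (a i) (a k)) ∧
        ∃ c ∈ Ioo (a i) (a k),
          (∀ y ∈ Ioo (a i) (a k), (lam ν).eval y = 0 ↔ y = c) ∧
          (∀ y ∈ Ioo (a i) (a k), xiSq ν y = 0 ↔ y = c) ∧
          meromorphicOrderAt (xiSq ν) c = ((2 * (ν : ℤ) - 1 : ℤ) : WithTop ℤ)) ∧
      -- (b) the component above the highest asymptote
      IsComponent (curve ν) {p ∈ curve ν | a ⟨ν - 1, by omega⟩ < p.2} ∧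
      (∃ yR yStar yL : ℝ,
        0 < yR ∧ yR < yStar ∧ yStar < 4 ∧ 4 < yL ∧
        StrictMonoOn (xiSq ν) (Ioc (a ⟨ν - 1, by omega⟩) yR) ∧
        xiSq ν 0 = 0 ∧
        -- simple turning point on the right
        0 < xiSq ν yR ∧ deriv (xiSq ν) yR = 0 ∧ deriv (deriv (xiSq ν)) yR < 0 ∧
        (∀ w : ℝ, 0 < w → IsZeroAt (fun y => d (-1) ν w y / r 1 ν w y) yR) ∧
        StrictAntiOn (xiSq ν) (Icc yR yL) ∧
        -- crossing of the `y₀`-axis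
        (∀ y : ℝ, 0 < y → ((lam ν).eval y = 0 ↔ y = yStar)) ∧
        (∀ y : ℝ, 0 < y → (xiSq ν y = 0 ↔ y = yStar)) ∧
        meromorphicOrderAt (xiSq ν) yStar = ((2 * (ν : ℤ) - 1 : ℤ) : WithTop ℤ) ∧
        -- simple turning point on the left
        xiSq ν yL < 0 ∧ deriv (xiSq ν) yL = 0 ∧ 0 < deriv (deriv (xiSq ν)) yL ∧
        (∀ w : ℝ, 0 < w →
          IsLeast {y : ℝ | 0 < y ∧ IsZeroAt (fun x => d 1 ν w x / r (-1) ν w x) y} yL) ∧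
        StrictMonoOn (xiSq ν) (Ici yL) ∧
        Tendsto (xiSq ν) atTop (𝓝[<] 0) ∧
        -- there are no other real turning points
        {y : ℝ | (B12 ν).eval y ≠ 0 ∧ IsLocalExtr (xiSq ν) y} = {yR, yL}) ∧
      -- the component below the lowest asymptote
      IsComponent (curve ν) {p ∈ curve ν | p.2 < a ⟨0, by omega⟩} ∧
      StrictMonoOn (xiSq ν) (Iio (a ⟨0, by omega⟩)) ∧
      Tendsto (xiSq ν) atBot (𝓝[>] 0) ∧
      -- order of tangency to the `y₀`-axis at `y₀ = ±∞`
      meromorphicOrderAt (fun t => xiSq ν t⁻¹) 0 = ((2 * (ν : ℤ) - 1 : ℤ) : WithTop ℤ)) ∧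
    -- (c)
    (∃ N : ℝ[X], N.natDegree = 2 * ν ∧ IsCoprime N (B12 ν) ∧
      ∀ ζ : ℂ, aeval (ζ ^ 2) (B12 ν) ≠ 0 →
        DHat ν ζ = (ζ ^ 2 - 4) * (aeval (ζ ^ 2) N / aeval (ζ ^ 2) (B12 ν) ^ 2)) := by
  obtain ⟨a, ha, hneg, hprod⟩ := exists_zeros_B12 ν
  have hroot : ∀ y : ℝ, (B12 ν).eval y = 0 ↔ ∃ i, y = a i := by
    intro y
    rw [hprod, eval_prod, Finset.prod_eq_zero_iff]
    simp [sub_eq_zero]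
  have hai : ∀ i, (B12 ν).eval (a i) = 0 := fun i => (hroot _).2 ⟨i, rfl⟩
  have hlast : ∀ y, a ⟨ν - 1, by omega⟩ < y → (B12 ν).eval y ≠ 0 := by
    intro y hy h
    obtain ⟨i, rfl⟩ := (hroot y).1 h
    have := ha.lt_iff_lt.1 hy
    rw [Fin.lt_def] at this
    have := i.2
    simp only at *
    omega
  have hfirst : ∀ y, y < a ⟨0, by omega⟩ → (B12 ν).eval y ≠ 0 := by
    intro y hy h
    obtain ⟨i, rfl⟩ := (hroot y).1 h
    have := ha.lt_iff_lt.1 hy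
    rw [Fin.lt_def] at this
    simp at this
  refine ⟨⟨a, ha, hneg, ?_, ?_, fun i => xiSq_pole hν (hai i), ?_, ?_,
    xiSq_above_poles hν (hneg _) hlast, ?_, ?_, (xiSq_infinity hν).2.1, (xiSq_infinity hν).2.2⟩,
    -turning ν, ?_, (isCoprime_turning_B12 ν hν).neg_left, fun ζ hζ => DHat_eq ν hζ⟩
  · intro z
    rw [hprod, map_prod, Finset.prod_eq_zero_iff]
    simp [sub_eq_zero]
  · intro b
    rw [isHorizontalAsymptote_iff hν, hroot]
  · intro i k hik
    refine xiSq_between_poles hν (ha (by rw [Fin.lt_def]; omega)) (hai i) (hai k) ?_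
    intro y hy h
    obtain ⟨l, rfl⟩ := (hroot y).1 h
    have h1 := ha.lt_iff_lt.1 hy.1
    have h2 := ha.lt_iff_lt.1 hy.2
    rw [Fin.lt_def] at h1 h2
    omega
  · refine isComponent_curve hν (I := Ioi (a ⟨ν - 1, by omega⟩)) isPreconnected_Ioi nonempty_Ioi
      hlast fun y hy t ht => ⟨_, ?_, hai ⟨ν - 1, by omega⟩⟩
    exact mem_uIcc.2 (Or.inr ⟨not_lt.1 ht, le_of_lt hy⟩)
  · refine isComponent_curve hν (I := Iio (a ⟨0, by omega⟩)) isPreconnected_Iio nonempty_Iio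
      hfirst fun y hy t ht => ⟨_, ?_, hai ⟨0, by omega⟩⟩
    exact mem_uIcc.2 (Or.inl ⟨le_of_lt hy, not_lt.1 ht⟩)
  · refine strictMonoOn_xiSq hν (convex_Iio _) hfirst fun y hy => ?_
    exact eval_turning_pos_of_nonpos ν ((interior_subset hy).trans (hneg _)).le hν
  · rw [natDegree_neg, turning_degree ν hν]
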